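/- Let $d,M\ge 1$ and let $H=H(x,p)\in C^\infty(\mathbb R^d\times\mathbb R^d;\mathbb R)$ be such that the Hamiltonian system $\dot x=\nabla_pH(x,p)$, $\dot p=-\nabla_xH(x,p)$ has, for every initial point $(x^{(0)},p^{(0)})$, a solution defined for all $t\in\mathbb R$. Let $u_0^{[1]},\dots,u_0^{[M]}\in C^1(\mathbb R^d;\mathbb R^d)$ (these are the initial values $u^{[k]}(0,\cdot)$). **Level-set functions.** For every $k$ there is exactly one $\phi^{[k]}:[0,\infty)\times\mathbb R^{2d}\to\mathbb R^d$, continuous on $[0,\infty)\times\mathbb R^{2d}$ and $C^1$ on $(0,\infty)\times\mathbb R^{2d}$, with $$\partial_t\phi^{[k]}+\nabla_pH\cdot\nabla_x\phi^{[k]}-\nabla_xH\cdot\nabla_p\phi^{[k]}=0\quad(t>0),\qquad \phi^{[k]}(0,x,p)=p-u_0^{[k]}(x).$$ **Linear equation.** For all $k$ and $t\ge0$ the distribution $\delta(\phi^{[k]}(t,\cdot,\cdot))\in\mathcal D'(\mathbb R^{2d})$ exists; here, for $f:\mathbb R^{2d}\to\mathbb R^d$, $\delta(f)$ is defined by $$\langle\delta(f),g\rangle=\lim_{\varepsilon\to0^+}\int_{\mathbb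 R^{2d}}\varepsilon^{-d}\eta\big(f(x,p)/\varepsilon\big)\,g(x,p)\,dx\,dp\qquad (g\in C_c^\infty(\mathbb R^{2d})),$$ the limit being required to exist and to be the same for every $\eta\in C_c^\infty(\mathbb R^d)$ with $\int\eta=1$. The Cauchy problem $$\partial_t\psi+\nabla_pH\cdot\nabla_x\psi-\nabla_xH\cdot\nabla_p\psi=0,\qquad \psi(0,x,p)=\frac1M\sum_{k=1}^M\prod_{i=1}^d\delta\big(p_i-u^{[k]}_{0,i}(x)\big)$$ has exactly one distributional solution, and it is $$\psi(t,\cdot,\cdot)=\frac1M\sum_{k=1}^M\delta\big(\phi^{[k]}(t,\cdot,\cdot)\big)\qquad(t\ge0).$$ Here the initial datum is the distribution $\psi_0:g\mapsto\frac1M\sum_k\int_{\mathbb R^d}g(x,u^{[k]}_0(x))\,dx$. A distributional solution is a family $\psi(t)\in\mathcal D'(\mathbb R^{2d})$, $t\ge0$, with $\psi(0)=\psi_0$, such that $t\mapsto\langle\psi(t),h\rangle$ is continuous on $[0,\infty)$ for every $h\in C_c^\infty(\mathbb R^{2d})$, and such that for every $g\in C_c^\infty(\mathbb R\times\mathbb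 R^{2d})$ the function $t\mapsto\langle\psi(t),g(t)\rangle$ is integrable on $(0,\infty)$ and $$\int_0^\infty\big\langle\psi(t),(\partial_t+\nabla_pH\cdot\nabla_x-\nabla_xH\cdot\nabla_p)g(t)\big\rangle\,dt+\langle\psi_0,g(0)\rangle=0.$$ **Exact representation of the Hamilton–Jacobi problem.** If, for some $k$ and $T$, $S\in C^2([0,T)\times\mathbb R^d)$ solves $\partial_tS+H(x,\nabla S)=0$ on $(0,T)\times\mathbb R^d$ with $\nabla S(0,\cdot)=u_0^{[k]}$, then for all $t\in[0,T)$ and $x,p\in\mathbb R^d$: $\ \phi^{[k]}(t,x,p)=0$ if and only if $p=\nabla S(t,x)$. -/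

import Mathlib

open MeasureTheory Set Filter Topology TopologicalSpace
open scoped ContDiff Gradient Distributions

namespace LiouvilleLevelSet

noncomputable section

/-- Configuration (or momentum) space, i.e. `ℝ^d` with its Euclidean structure. -/
abbrev Cfg (d : ℕ) : Type := EuclideanSpace ℝ (Fin d)

/-- Phase space, with points `(x, p)`. -/
abbrev Phase (d : ℕ) : Type := Cfg d × Cfg d

/-- Real-valued test functions (smooth, compactly supported) on phase space. -/
abbrev PhaseTest (d : ℕ) : Type := 𝓓((⊤ : Opens (Phase d)), ℝ)

/-- Test functions of `(t, (x, p))`; they need not vanish at `t = 0`. -/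
abbrev SpaceTimeTest (d : ℕ) : Type := 𝓓((⊤ : Opens (ℝ × Phase d)), ℝ)

/-- Real distributions on phase space. -/
abbrev PhaseDistribution (d : ℕ) : Type := 𝓓'((⊤ : Opens (Phase d)), ℝ)

variable {d : ℕ}

/-- The partial gradient `∇_x H` at `z = (x, p)`. -/
def gradX (H : Phase d → ℝ) (z : Phase d) : Cfg d := ∇ (fun x => H (x, z.2)) z.1

/-- The partial gradient `∇_p H` at `z = (x, p)`. -/
def gradP (H : Phase d → ℝ) (z : Phase d) : Cfg d := ∇ (fun p => H (z.1, p)) z.2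

/-- `γ = (x(·), p(·))` solves `x' = ∇_p H(x, p)`, `p' = -∇_x H(x, p)` for all times. -/
def IsBicharacteristic (H : Phase d → ℝ) (γ : ℝ → Phase d) : Prop :=
  ∀ t, HasDerivAt γ (gradP H (γ t), -gradX H (γ t)) t

/-- Through every point of phase space there passes a bicharacteristic defined for all times. -/
def HasCompleteFlow (H : Phase d → ℝ) : Prop :=
  ∀ z : Phase d, ∃ γ : ℝ → Phase d, γ 0 = z ∧ IsBicharacteristic H γ

/-- `φ : [0,∞) × ℝ^d × ℝ^d → ℝ^d` is a classical solution of the (componentwise) Liouville equation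
`∂_t φ + ∇_p H · ∇_x φ - ∇_x H · ∇_p φ = 0` with initial datum `φ(0,x,p) = p - u₀(x)`.
Only the values of `φ` at times `t ≥ 0` matter. -/
structure IsLevelSetFunction (H : Phase d → ℝ) (u₀ : Cfg d → Cfg d)
    (φ : ℝ → Phase d → Cfg d) : Prop where
  continuousOn : ContinuousOn (fun q : ℝ × Phase d => φ q.1 q.2) (Ici 0 ×ˢ univ)
  contDiffOn : ContDiffOn ℝ 1 (fun q : ℝ × Phase d => φ q.1 q.2) (Ioi 0 ×ˢ univ)
  equation : ∀ t, 0 < t → ∀ x p : Cfg d,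
    deriv (fun s => φ s (x, p)) t
      + fderiv ℝ (fun y => φ t (y, p)) x (gradP H (x, p))
      - fderiv ℝ (fun q => φ t (x, q)) p (gradX H (x, p)) = 0
  initial : ∀ x p : Cfg d, φ 0 (x, p) = p - u₀ x

/-- The composition `δ(f)` of the `d`-dimensional Dirac delta with `f : ℝ^{2d} → ℝ^d`: the
distribution `T` is the limit of `η_ε ∘ f` as `ε → 0+`, for every smooth compactly supported
mollifier `η_ε(y) = ε^{-d} η(y/ε)` with `∫ η = 1`. -/
def IsDeltaComp (f : Phase d → Cfg d) (T : PhaseDistribution d) : Prop :=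
  ∀ η : Cfg d → ℝ, ContDiff ℝ ∞ η → HasCompactSupport η → ∫ y, η y = 1 →
    ∀ g : PhaseTest d,
      Tendsto (fun ε : ℝ => ∫ z : Phase d, (ε ^ d)⁻¹ * η (ε⁻¹ • f z) * g z) (𝓝[>] 0) (𝓝 (T g))

/-- The pairing of `∏ᵢ δ(pᵢ - uᵢ(x))` with a test function `g(x, p)`: for each `x` the product over
`i` of the one-dimensional Dirac measures at `uᵢ(x)` is integrated against `g(x, ·)`, and the result
is integrated over `x`. -/
def prodDeltaPairing (u : Cfg d → Cfg d) (g : PhaseTest d) : ℝ :=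
  ∫ x : Cfg d, ∫ p : Fin d → ℝ, g (x, WithLp.toLp 2 p)
    ∂(Measure.pi fun i => Measure.dirac (u x i))

theorem prodDeltaPairing_eq (u : Cfg d → Cfg d) (g : PhaseTest d) :
    prodDeltaPairing u g = ∫ x : Cfg d, g (x, u x) := by
  have key : ∀ v : Fin d → ℝ,
      (Measure.pi fun i => Measure.dirac (v i)) = Measure.dirac v := by
    intro v
    refine Measure.pi_eq fun s hs => ?_
    rw [Measure.dirac_apply' _ (MeasurableSet.univ_pi hs)]
    simp only [Measure.dirac_apply' _ (hs _)]
    by_cases h : v ∈ univ.pi s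
    · rw [indicator_of_mem h]
      exact (Finset.prod_eq_one fun i _ => by
        rw [indicator_of_mem (h i (mem_univ i))]; rfl).symm
    · rw [indicator_of_notMem h]
      simp only [Set.mem_pi, mem_univ, true_implies, not_forall] at h
      obtain ⟨i, hi⟩ := h
      exact (Finset.prod_eq_zero (Finset.mem_univ i) (indicator_of_notMem hi _)).symm
  unfold prodDeltaPairing
  refine integral_congr_ae (Eventually.of_forall fun x => ?_)
  change ∫ p : Fin d → ℝ, g (x, WithLp.toLp 2 p)
    ∂(Measure.pi fun i => Measure.dirac (u x i)) = g (x, u x)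
  rw [key (fun i => u x i), integral_dirac]

theorem contDiff_gradX {H : Phase d → ℝ} (hH : ContDiff ℝ ∞ H) : ContDiff ℝ ∞ (gradX H) := by
  unfold gradX gradient
  refine (InnerProductSpace.toDual ℝ (Cfg d)).symm.toContinuousLinearEquiv.contDiff.comp ?_
  exact ContDiff.fderiv (f := fun (z : Phase d) (x : Cfg d) => H (x, z.2))
    (hH.comp (contDiff_snd.prodMk (contDiff_snd.comp contDiff_fst))) contDiff_fst (by simp)

theorem contDiff_gradP {H : Phase d → ℝ} (hH : ContDiff ℝ ∞ H) : ContDiff ℝ ∞ (gradP H) := by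
  unfold gradP gradient
  refine (InnerProductSpace.toDual ℝ (Cfg d)).symm.toContinuousLinearEquiv.contDiff.comp ?_
  exact ContDiff.fderiv (f := fun (z : Phase d) (p : Cfg d) => H (z.1, p))
    (hH.comp ((contDiff_fst.comp contDiff_fst).prodMk contDiff_snd)) contDiff_snd (by simp)

/-- The restriction `g(t, ·)` of a space-time test function to a fixed time. -/
def timeSlice (g : SpaceTimeTest d) (t : ℝ) : PhaseTest d where
  toFun z := g (t, z)
  contDiff' := g.contDiff.comp (contDiff_const.prodMk contDiff_id)
  hasCompactSupport' := by
    refine HasCompactSupport.of_support_subset_isCompact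
      (g.hasCompactSupport.isCompact.image continuous_snd) fun z hz => ?_
    exact ⟨(t, z), subset_tsupport _ hz, rfl⟩
  tsupport_subset' := by simp

/-- `∂_t g + ∇_p H · ∇_x g - ∇_x H · ∇_p g` for a space-time test function `g`, as a test function
(the derivative of `g` in the direction `(1, ∇_p H, -∇_x H)`). -/
def liouvilleTest (H : Phase d → ℝ) (hH : ContDiff ℝ ∞ H) (g : SpaceTimeTest d) :
    SpaceTimeTest d where
  toFun q := fderiv ℝ g q (1, (gradP H q.2, -gradX H q.2))
  contDiff' := by
    have h1 : ContDiff ℝ ∞ (fderiv ℝ g) :=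
      ContDiff.fderiv_right (m := ∞) g.contDiff (by simp)
    exact h1.clm_apply (contDiff_const.prodMk
      (((contDiff_gradP hH).comp contDiff_snd).prodMk ((contDiff_gradX hH).comp contDiff_snd).neg))
  hasCompactSupport' := by
    refine HasCompactSupport.of_support_subset_isCompact
      (g.hasCompactSupport.fderiv (𝕜 := ℝ)).isCompact fun q hq => ?_
    refine subset_tsupport _ fun h => hq ?_
    change fderiv ℝ g q _ = 0
    rw [h]; rfl
  tsupport_subset' := by simp

/-- `ψ : [0,∞) → 𝓓'` is a distributional solution of the Cauchy problem
`∂_t ψ + ∇_p H · ∇_x ψ - ∇_x H · ∇_p ψ = 0`, `ψ(0) = ψ₀`. The transport field `(∇_p H, -∇_x H)` is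
divergence free, so the weak form is
`∫₀^∞ ⟨ψ(t), (∂_t + ∇_p H · ∇_x - ∇_x H · ∇_p) g(t)⟩ dt + ⟨ψ₀, g(0)⟩ = 0`
for all test functions `g`. Only the values of `ψ` at times `t ≥ 0` matter. -/
structure IsLiouvilleSolution (H : Phase d → ℝ) (hH : ContDiff ℝ ∞ H)
    (ψ₀ : PhaseTest d → ℝ) (ψ : ℝ → PhaseDistribution d) : Prop where
  initial : ∀ h : PhaseTest d, ψ 0 h = ψ₀ h
  continuousOn : ∀ h : PhaseTest d, ContinuousOn (fun t => ψ t h) (Ici 0)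
  integrableOn : ∀ g : SpaceTimeTest d, IntegrableOn (fun t => ψ t (timeSlice g t)) (Ioi 0)
  weak : ∀ g : SpaceTimeTest d,
    (∫ t in Ioi (0 : ℝ), ψ t (timeSlice (liouvilleTest H hH g) t)) + ψ₀ (timeSlice g 0) = 0

/-- `S` is a twice continuously differentiable solution on `[0,T) × ℝ^d` of the Hamilton-Jacobi
equation `∂_t S + H(x, ∇S) = 0`, with `∇S(0, ·) = u₀`. -/
structure IsHamiltonJacobiSolution (H : Phase d → ℝ) (u₀ : Cfg d → Cfg d) (T : ℝ)
    (S : ℝ → Cfg d → ℝ) : Prop where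
  contDiffOn : ContDiffOn ℝ 2 (fun q : ℝ × Cfg d => S q.1 q.2) (Ico 0 T ×ˢ univ)
  equation : ∀ t ∈ Ioo 0 T, ∀ x, deriv (fun s => S s x) t + H (x, ∇ (S t) x) = 0
  initial : ∀ x, ∇ (S 0) x = u₀ x

end

end LiouvilleLevelSet

open LiouvilleLevelSet

/-!
All assertions are read off from the flow `Φ` of the Hamiltonian vector field
`V = (∇_p H, -∇_x H)`, which is complete by hypothesis.

*The flow is smooth* (`IsFlow.contDiff`). For small `τ` the rescaled trajectory
`s ↦ Φ (τ s) z` on `[0, 1]` is the solution of `γ = z + τ ∫ V ∘ γ` in the Banach space of continuous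
curves. Composition with `V` is a smooth operation there (`contDiff_postcomp`), and at `τ = 0` the
equation is trivially solvable, so the implicit function theorem gives smoothness for short times.
The group law propagates it to all times. The flow also preserves phase-space integrals
(`integral_comp_hamFlow`): the time derivative of `∫ k ∘ Φ_t` is `∫ V · ∇(k ∘ Φ_t)`, which vanishes
after an integration by parts because `V` is divergence free.

*Level-set functions.* Being constant along trajectories, `φ` must be `w ∘ Φ_{-t}` with
`w(x, p) = p - u₀(x)`, and this function is a solution.

*The delta distributions.* By volume preservation `δ(w ∘ Φ_{-t})` is the image under `Φ_t` of
`δ(w)`, and rescaling the momentum around the graph shows that `δ(w)` is integration over the graph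
of `u₀` (`isDeltaComp_comp_flow`).

*The Liouville equation.* Images of a measure under `Φ_t` solve it, since
`d/dt g(t, Φ_t z) = (∂_t g + V · ∇g)(t, Φ_t z)` (`isLiouvilleSolution_of_transport`). For uniqueness,
Duhamel's formula solves the adjoint equation `∂_t g + V · ∇g = θ(t) h(z)` in test functions
(`exists_liouvilleTest_eq`); inserting `g` into the weak equation determines `∫ θ(t) ⟨ψ(t), h⟩ dt`
for all `θ`, and hence `⟨ψ(t), h⟩` by continuity in `t`. Since `ψ(t)` may have any order, this is
where the flow has to be `C^∞`.

*The Hamilton–Jacobi equation.* Along a trajectory `(X, P)` the difference `P - ∇S(t, X)` satisfies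
a linear differential inequality, so the trajectory lies on the graph of `∇S(t, ·)` at time `t` if
and only if it starts on the graph of `u₀` (`IsHamiltonJacobiSolution.mem_graph_iff`).
-/

namespace LiouvilleLevelSet

/-! ### Composition operators on spaces of continuous maps -/

section Nemytskii

universe u

variable {K : Type*} [TopologicalSpace K] [CompactSpace K]
variable {E F : Type u} [NormedAddCommGroup E] [NormedSpace ℝ E] [NormedAddCommGroup F]
  [NormedSpace ℝ F]

/-- Pointwise application `(A, δ) ↦ (s ↦ A s (δ s))` of a continuous family of operators, as a
continuous bilinear map. -/
noncomputable def pointwiseApply (K : Type*) [TopologicalSpace K] [CompactSpace K]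
    (E F : Type*) [NormedAddCommGroup E] [NormedSpace ℝ E] [NormedAddCommGroup F]
    [NormedSpace ℝ F] : C(K, E →L[ℝ] F) →L[ℝ] C(K, E) →L[ℝ] C(K, F) :=
  LinearMap.mkContinuous₂
    (LinearMap.mk₂ ℝ (fun (A : C(K, E →L[ℝ] F)) (δ : C(K, E)) =>
        (⟨fun s => A s (δ s), A.continuous.clm_apply δ.continuous⟩ : C(K, F)))
      (fun _ _ _ => by ext; simp) (fun _ _ _ => by ext; simp)
      (fun _ _ _ => by ext; simp) (fun _ _ _ => by ext; simp)) 1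
    (fun A δ => by
      refine (ContinuousMap.norm_le _ (by positivity)).2 fun s => ?_
      rw [one_mul]
      change ‖A s (δ s)‖ ≤ _
      exact ((A s).le_opNorm _).trans
        (mul_le_mul (A.norm_coe_le_norm s) (δ.norm_coe_le_norm s) (norm_nonneg _)
          (by positivity)))

theorem hasFDerivAt_postcomp {V : E → F} (hV : ContDiff ℝ 1 V) (γ : C(K, E)) :
    HasFDerivAt (fun γ : C(K, E) => (⟨V, hV.continuous⟩ : C(E, F)).comp γ)
      (pointwiseApply K E F
        ((⟨fderiv ℝ V, hV.continuous_fderiv one_ne_zero⟩ : C(E, E →L[ℝ] F)).comp γ)) γ := by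
  set V' : C(E, E →L[ℝ] F) := ⟨fderiv ℝ V, hV.continuous_fderiv one_ne_zero⟩
  refine HasFDerivAt.of_isLittleO (Asymptotics.isLittleO_iff.2 fun ε hε => ?_)
  have hc : ContinuousAt (fun γ : C(K, E) => V'.comp γ) γ :=
    (ContinuousMap.continuous_postcomp V').continuousAt
  obtain ⟨δ, hδ, hball⟩ := (Metric.continuousAt_iff (α := C(K, E)) (β := C(K, E →L[ℝ] F))).1 hc ε hε
  filter_upwards [Metric.ball_mem_nhds γ hδ] with η hη
  refine (ContinuousMap.norm_le _ (by positivity)).2 fun s => ?_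
  have hseg : ∀ y ∈ segment ℝ (γ s) (η s), ‖fderiv ℝ V y - fderiv ℝ V (γ s)‖ ≤ ε := by
    rintro y hy
    rw [segment_eq_image'] at hy
    obtain ⟨θ, hθ, rfl⟩ := hy
    have hθη : γ + θ • (η - γ) ∈ Metric.ball γ δ := by
      rw [Metric.mem_ball, dist_eq_norm, add_sub_cancel_left, norm_smul, Real.norm_eq_abs,
        abs_of_nonneg hθ.1]
      rw [Metric.mem_ball, dist_eq_norm] at hη
      exact (mul_le_of_le_one_left (norm_nonneg _) hθ.2).trans_lt hη
    rw [← dist_eq_norm]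
    exact (ContinuousMap.dist_apply_le_dist (f := V'.comp (γ + θ • (η - γ))) (g := V'.comp γ)
      s).trans (hball hθη).le
  have h := (convex_segment (γ s) (η s)).norm_image_sub_le_of_norm_fderiv_le'
    (fun y _ => (hV.differentiable one_ne_zero) y) hseg (left_mem_segment ℝ _ _)
    (right_mem_segment ℝ _ _)
  exact h.trans (mul_le_mul_of_nonneg_left ((η - γ).norm_coe_le_norm s) hε.le)

/-- Composition with a `C^n` map is a `C^n` operation on continuous maps from a compact space. -/
theorem contDiff_postcomp (n : ℕ) {V : E → F} (hV : ContDiff ℝ n V) :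
    ContDiff ℝ n (fun γ : C(K, E) => (⟨V, hV.continuous⟩ : C(E, F)).comp γ) := by
  induction n generalizing F with
  | zero => exact contDiff_zero.2 (ContinuousMap.continuous_postcomp _)
  | succ n ih =>
    have h1 : ContDiff ℝ 1 V := hV.of_le (by exact_mod_cast Nat.le_add_left 1 n)
    have h2 : ContDiff ℝ n (fderiv ℝ V) := hV.fderiv_right (by norm_cast)
    refine (contDiff_succ_iff_hasFDerivAt (n := n)).2
      ⟨_, ?_, fun γ => hasFDerivAt_postcomp h1 γ⟩
    exact (pointwiseApply K E F).contDiff.comp (ih h2)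

end Nemytskii

/-! ### Smoothness of complete flows -/

section Flow

variable {E : Type} [NormedAddCommGroup E] [NormedSpace ℝ E]

/-- The operator `f ↦ (s ↦ ∫₀ˢ f)` on continuous maps of the unit interval. -/
noncomputable def primitiveCLM (E : Type*) [NormedAddCommGroup E] [NormedSpace ℝ E] :
    C(Icc (0 : ℝ) 1, E) →L[ℝ] C(Icc (0 : ℝ) 1, E) :=
  LinearMap.mkContinuous
    { toFun f := ⟨fun s => ∫ r in (0 : ℝ)..s, f (projIcc 0 1 zero_le_one r),
        (intervalIntegral.continuous_primitive
          (fun a b => (f.continuous.comp continuous_projIcc).intervalIntegrable a b) 0).comp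
          continuous_subtype_val⟩
      map_add' f g := by
        ext s
        exact intervalIntegral.integral_add
          ((f.continuous.comp continuous_projIcc).intervalIntegrable _ _)
          ((g.continuous.comp continuous_projIcc).intervalIntegrable _ _)
      map_smul' c f := by
        ext s
        exact intervalIntegral.integral_smul _ _ } 1
    (fun f => by
      refine (ContinuousMap.norm_le _ (by positivity)).2 fun s => ?_
      have h := intervalIntegral.norm_integral_le_of_norm_le_const (a := 0) (b := (s : ℝ))
        (f := fun r => f (projIcc 0 1 zero_le_one r)) (C := ‖f‖)
        (fun r _ => f.norm_coe_le_norm _)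
      refine h.trans ?_
      rw [sub_zero, abs_of_nonneg s.2.1, mul_comm]
      exact mul_le_mul_of_nonneg_right s.2.2 (norm_nonneg _))

theorem primitiveCLM_apply (f : C(Icc (0 : ℝ) 1, E)) (s : Icc (0 : ℝ) 1) :
    primitiveCLM E f s = ∫ r in (0 : ℝ)..s, f (projIcc 0 1 zero_le_one r) := rfl

/-- Global integral curves of a `C^1` vector field are determined by their value at one time. -/
theorem eq_of_integralCurves {V : E → E} (hV : ContDiff ℝ 1 V) {f g : ℝ → E}
    (hf : ∀ t, HasDerivAt f (V (f t)) t) (hg : ∀ t, HasDerivAt g (V (g t)) t) {t₀ : ℝ}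
    (h : f t₀ = g t₀) : f = g := by
  have hcf : Continuous f := continuous_iff_continuousAt.2 fun t => (hf t).continuousAt
  have hcg : Continuous g := continuous_iff_continuousAt.2 fun t => (hg t).continuousAt
  have hcl : IsClopen {t | f t = g t} := by
    refine ⟨isClosed_eq hcf hcg, isOpen_iff_mem_nhds.2 fun t ht => ?_⟩
    obtain ⟨K, s, hs, hK⟩ := (hV.contDiffAt (x := f t)).exists_lipschitzOnWith
    have hgs : s ∈ 𝓝 (g t) := by rwa [← (ht : f t = g t)]
    exact ODE_solution_unique_of_eventually (v := fun _ => V) (s := fun _ => s)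
      (Eventually.of_forall fun _ => hK)
      ((hcf.continuousAt.eventually_mem hs).mono fun r hr => ⟨hf r, hr⟩)
      ((hcg.continuousAt.eventually_mem hgs).mono fun r hr => ⟨hg r, hr⟩) ht
  have huniv := hcl.eq_univ ⟨t₀, h⟩
  funext t
  exact (huniv ▸ mem_univ t : t ∈ {t | f t = g t})

/-- `Φ` is the complete flow of the vector field `V`. -/
structure IsFlow (V : E → E) (Φ : ℝ → E → E) : Prop where
  zero : ∀ z, Φ 0 z = z
  hasDerivAt : ∀ z t, HasDerivAt (fun s => Φ s z) (V (Φ t z)) t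

namespace IsFlow

variable {V : E → E} {Φ : ℝ → E → E}

theorem add (hΦ : IsFlow V Φ) (hV : ContDiff ℝ 1 V) (s t : ℝ) (z : E) :
    Φ (s + t) z = Φ s (Φ t z) := by
  have h := eq_of_integralCurves hV (f := fun s => Φ (s + t) z) (g := fun s => Φ s (Φ t z))
    (fun r => (hΦ.hasDerivAt z (r + t)).comp_add_const r t)
    (fun r => hΦ.hasDerivAt _ r) (t₀ := 0) (by simp [hΦ.zero])
  exact congrFun h s

theorem neg_apply (hΦ : IsFlow V Φ) (hV : ContDiff ℝ 1 V) (t : ℝ) (z : E) :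
    Φ (-t) (Φ t z) = z := by
  rw [← hΦ.add hV, neg_add_cancel, hΦ.zero]

theorem apply_neg (hΦ : IsFlow V Φ) (hV : ContDiff ℝ 1 V) (t : ℝ) (z : E) :
    Φ t (Φ (-t) z) = z := by
  rw [← hΦ.add hV, add_neg_cancel, hΦ.zero]

theorem continuous_time (hΦ : IsFlow V Φ) (z : E) : Continuous fun t => Φ t z :=
  continuous_iff_continuousAt.2 fun t => (hΦ.hasDerivAt z t).continuousAt

/-- Uniqueness on the unit interval for the equation with time rescaled by `τ`. -/
theorem eqOn_unitInterval [ProperSpace E] (hΦ : IsFlow V Φ) (hV : ContDiff ℝ 1 V) {τ : ℝ}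
    {γ : ℝ → E} (hγ : ContinuousOn γ (Icc 0 1))
    (hγ' : ∀ s ∈ Ico (0 : ℝ) 1, HasDerivWithinAt γ (τ • V (γ s)) (Ici s) s) :
    ∀ s ∈ Icc (0 : ℝ) 1, γ s = Φ (τ * s) (γ 0) := by
  have hgc : Continuous fun s => Φ (τ * s) (γ 0) :=
    (hΦ.continuous_time _).comp (continuous_const.mul continuous_id)
  obtain ⟨R, hR⟩ := ((isCompact_Icc.image_of_continuousOn hγ).union
    (isCompact_Icc.image hgc)).isBounded.subset_closedBall (0 : E)
  obtain ⟨C, hC⟩ := (isCompact_closedBall (0 : E) R).exists_bound_of_continuousOn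
    (f := fun z => τ • fderiv ℝ V z)
    ((hV.continuous_fderiv one_ne_zero).const_smul τ).continuousOn
  have hLip : LipschitzOnWith C.toNNReal (fun z => τ • V z) (Metric.closedBall 0 R) := by
    refine Convex.lipschitzOnWith_of_nnnorm_hasFDerivWithin_le (𝕜 := ℝ)
      (f' := fun z => τ • fderiv ℝ V z) (fun z _ => ?_) (fun z hz => ?_) (convex_closedBall 0 R)
    · exact (((hV.differentiable one_ne_zero) z).hasFDerivAt.const_smul τ).hasFDerivWithinAt
    · rw [← NNReal.coe_le_coe, coe_nnnorm]
      exact (hC z hz).trans (Real.le_coe_toNNReal C)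
  refine ODE_solution_unique_of_mem_Icc_right (v := fun _ z => τ • V z)
    (s := fun _ => Metric.closedBall 0 R) (fun _ _ => hLip) hγ hγ'
    (fun s hs => hR (Or.inl ⟨s, Ico_subset_Icc_self hs, rfl⟩)) hgc.continuousOn
    (fun s _ => ?_) (fun s hs => hR (Or.inr ⟨s, Ico_subset_Icc_self hs, rfl⟩)) (by simp [hΦ.zero])
  have h := (hΦ.hasDerivAt (γ 0) (τ * s)).scomp s ((hasDerivAt_id s).const_mul τ)
  simpa [Function.comp_def] using h.hasDerivWithinAt

/-- Near time `0` the flow is as smooth as the field. The rescaled trajectory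
`s ↦ Φ (τ s) z`, `s ∈ [0, 1]`, solves `γ = z + τ ∫₀ V ∘ γ` in the Banach space of continuous maps
of the unit interval; at `τ = 0` the linearization of this equation in `γ` is the identity, so the
implicit function theorem applies. -/
theorem contDiffAt_zero [ProperSpace E] (hΦ : IsFlow V Φ) {n : ℕ} (hn : n ≠ 0)
    (hV : ContDiff ℝ n V) (z₀ : E) :
    ContDiffAt ℝ n (fun q : ℝ × E => Φ q.1 q.2) (0, z₀) := by
  have hn' : ((n : ℕ) : WithTop ℕ∞) ≠ 0 := by exact_mod_cast hn
  have hV1 : ContDiff ℝ 1 V := hV.of_le (by exact_mod_cast Nat.one_le_iff_ne_zero.2 hn)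
  let N : C(Icc (0 : ℝ) 1, E) → C(Icc (0 : ℝ) 1, E) :=
    fun γ => (⟨V, hV.continuous⟩ : C(E, E)).comp γ
  let cst : E →L[ℝ] C(Icc (0 : ℝ) 1, E) := ContinuousLinearMap.const ℝ _
  let G : (ℝ × E) × C(Icc (0 : ℝ) 1, E) → C(Icc (0 : ℝ) 1, E) :=
    fun q => q.2 - cst q.1.2 - q.1.1 • primitiveCLM E (N q.2)
  have hN : ContDiff ℝ n N := contDiff_postcomp n hV
  have hG : ContDiff ℝ n G :=
    (contDiff_snd.sub (cst.contDiff.comp (contDiff_snd.comp contDiff_fst))).sub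
      ((contDiff_fst.comp contDiff_fst).smul
        ((primitiveCLM E).contDiff.comp (hN.comp contDiff_snd)))
  let u : (ℝ × E) × C(Icc (0 : ℝ) 1, E) := ((0, z₀), cst z₀)
  have hGu : G u = 0 := by simp [G, u]
  have hinr : fderiv ℝ G u ∘L .inr ℝ (ℝ × E) C(Icc (0 : ℝ) 1, E) = ContinuousLinearMap.id ℝ _ := by
    have h1 : HasFDerivAt (fun γ => G ((0, z₀), γ))
        (fderiv ℝ G u ∘L .inr ℝ (ℝ × E) C(Icc (0 : ℝ) 1, E)) (cst z₀) :=
      ((hG.differentiable hn') u).hasFDerivAt.comp (cst z₀)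
        (hasFDerivAt_prodMk_right (0, z₀) (cst z₀))
    have h2 : HasFDerivAt (fun γ => G ((0, z₀), γ)) (ContinuousLinearMap.id ℝ _) (cst z₀) := by
      have : (fun γ => G ((0, z₀), γ)) = fun γ => γ - cst z₀ := by
        funext γ; simp [G]
      rw [this]
      exact (hasFDerivAt_id _).sub_const _
    exact h1.unique h2
  have hinv : (fderiv ℝ G u ∘L .inr ℝ (ℝ × E) C(Icc (0 : ℝ) 1, E)).IsInvertible := by
    rw [hinr]; exact ⟨ContinuousLinearEquiv.refl ℝ _, rfl⟩
  let ψ := (hG.contDiffAt (x := u)).implicitFunction hn' hinv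
  have hψ : ContDiffAt ℝ n ψ (0, z₀) := (hG.contDiffAt (x := u)).contDiffAt_implicitFunction hn' hinv
  have hψG : ∀ᶠ q in 𝓝 ((0 : ℝ), z₀), G (q, ψ q) = 0 := by
    have := (hG.contDiffAt (x := u)).eventually_apply_implicitFunction hn' hinv
    rwa [hGu] at this
  let one : Icc (0 : ℝ) 1 := ⟨1, by simp⟩
  have hev : ContDiffAt ℝ n (fun q => ψ q one) (0, z₀) :=
    (ContinuousMap.evalCLM (M := E) ℝ one).contDiff.contDiffAt.comp (0, z₀) hψ
  refine hev.congr_of_eventuallyEq ?_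
  filter_upwards [hψG] with q hq
  -- the fixed point equation, extended to all real times
  let γ : ℝ → E := fun s => q.2 + q.1 • ∫ r in (0 : ℝ)..s, V (ψ q (projIcc 0 1 zero_le_one r))
  have hγψ : ∀ s (hs : s ∈ Icc (0 : ℝ) 1), γ s = ψ q ⟨s, hs⟩ := by
    intro s hs
    have h := congrArg (fun f => f ⟨s, hs⟩) hq
    have h' : ψ q ⟨s, hs⟩ - q.2 - q.1 • primitiveCLM E (N (ψ q)) ⟨s, hs⟩ = 0 := h
    rw [primitiveCLM_apply] at h'
    rw [sub_sub, sub_eq_zero] at h'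
    exact h'.symm
  have hγ' : ∀ s, HasDerivAt γ (q.1 • V (ψ q (projIcc 0 1 zero_le_one s))) s := fun s => by
    have hc : Continuous fun r => V (ψ q (projIcc 0 1 zero_le_one r)) :=
      hV.continuous.comp ((ψ q).continuous.comp continuous_projIcc)
    exact ((intervalIntegral.integral_hasDerivAt_right (hc.intervalIntegrable _ _)
      hc.aestronglyMeasurable.stronglyMeasurableAtFilter hc.continuousAt).const_smul
        q.1).const_add _
  have h0 : γ 0 = q.2 := by simp [γ]
  have := hΦ.eqOn_unitInterval hV1 (τ := q.1) (γ := γ)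
    (fun s _ => (hγ' s).continuousAt.continuousWithinAt)
    (fun s hs => by
      have hs' := Ico_subset_Icc_self hs
      have h := (hγ' s).hasDerivWithinAt (s := Ici s)
      rwa [projIcc_of_mem zero_le_one hs', ← hγψ s hs'] at h) 1 (by simp)
  rw [hγψ 1 (by simp), h0, mul_one] at this
  exact this.symm

/-- A complete flow is jointly as smooth as its vector field. -/
theorem contDiff_nat [ProperSpace E] (hΦ : IsFlow V Φ) {n : ℕ} (hn : n ≠ 0)
    (hV : ContDiff ℝ n V) : ContDiff ℝ n (fun q : ℝ × E => Φ q.1 q.2) := by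
  have hV1 : ContDiff ℝ 1 V := hV.of_le (by exact_mod_cast Nat.one_le_iff_ne_zero.2 hn)
  have hloc := fun z => hΦ.contDiffAt_zero hn hV z
  -- smoothness of the time-`t` map at `z` propagates to nearby times
  have key : ∀ t z, ContDiffAt ℝ n (Φ t) z →
      ContDiffAt ℝ n (fun q : ℝ × E => Φ q.1 q.2) (t, z) := by
    intro t z h
    have heq : (fun q : ℝ × E => Φ q.1 q.2) = fun q => Φ (q.1 - t) (Φ t q.2) := by
      funext q; rw [← hΦ.add hV1, sub_add_cancel]
    rw [heq]
    refine ContDiffAt.comp (t, z) (g := fun q : ℝ × E => Φ q.1 q.2)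
      (f := fun q : ℝ × E => (q.1 - t, Φ t q.2)) ?_ ?_
    · simpa using hloc (Φ t z)
    · exact (contDiffAt_fst.sub contDiffAt_const).prodMk (h.comp (t, z) contDiffAt_snd)
  have slice : ∀ t z, ContDiffAt ℝ n (fun q : ℝ × E => Φ q.1 q.2) (t, z) →
      ContDiffAt ℝ n (Φ t) z := fun t z h =>
    h.comp z (contDiffAt_const.prodMk contDiffAt_id)
  refine contDiff_iff_contDiffAt.2 fun ⟨t, z⟩ => key t z ?_
  have hcl : IsClopen {t | ContDiffAt ℝ n (Φ t) z} := by
    constructor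
    · refine isClosed_of_closure_subset fun t ht => ?_
      have hev := (hloc (Φ t z)).eventually (by simp)
      have hlim : Tendsto (fun s => (t - s, Φ s z)) (𝓝 t) (𝓝 (0, Φ t z)) := by
        have : Continuous fun s => (t - s, Φ s z) :=
          (continuous_const.sub continuous_id).prodMk (hΦ.continuous_time z)
        simpa using this.tendsto t
      obtain ⟨s, hs, hs'⟩ := ((mem_closure_iff_frequently.1 ht).and_eventually
        (hlim.eventually hev)).exists
      have heq : Φ t = fun y => Φ (t - s) (Φ s y) := by
        funext y; rw [← hΦ.add hV1, sub_add_cancel]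
      change ContDiffAt ℝ n (Φ t) z
      rw [heq]
      exact (slice _ _ hs').comp z hs
    · refine isOpen_iff_mem_nhds.2 fun t ht => ?_
      have hev := (key t z ht).eventually (by simp)
      have hlim : Tendsto (fun s => (s, z)) (𝓝 t) (𝓝 (t, z)) :=
        (continuous_id.prodMk continuous_const).tendsto t
      exact (hlim.eventually hev).mono fun s hs => slice s z hs
  have huniv := hcl.eq_univ ⟨0, by
    change ContDiffAt ℝ n (Φ 0) z
    rw [show Φ 0 = id from funext hΦ.zero]; exact contDiffAt_id⟩
  exact (huniv ▸ mem_univ t : t ∈ {t | ContDiffAt ℝ n (Φ t) z})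

theorem contDiff [ProperSpace E] (hΦ : IsFlow V Φ) (hV : ContDiff ℝ ∞ V) :
    ContDiff ℝ ∞ (fun q : ℝ × E => Φ q.1 q.2) :=
  contDiff_infty.2 fun n => (hΦ.contDiff_nat n.succ_ne_zero
    (contDiff_infty.1 hV (n + 1))).of_le (by exact_mod_cast n.le_succ)

end IsFlow

end Flow

/-! ### Integrals transported by a flow -/

namespace IsFlow

variable {E : Type} [NormedAddCommGroup E] [NormedSpace ℝ E] {V : E → E} {Φ : ℝ → E → E}

theorem hasDerivAt_comp {F : Type*} [NormedAddCommGroup F] [NormedSpace ℝ F] (hΦ : IsFlow V Φ)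
    {g : ℝ × E → F} {t : ℝ} {z : E} (hg : DifferentiableAt ℝ g (t, Φ t z)) :
    HasDerivAt (fun s => g (s, Φ s z)) (fderiv ℝ g (t, Φ t z) (1, V (Φ t z))) t :=
  hg.hasFDerivAt.comp_hasDerivAt t ((hasDerivAt_id t).prodMk (hΦ.hasDerivAt z t))

variable [ProperSpace E]

theorem continuous (hΦ : IsFlow V Φ) (hV : ContDiff ℝ ∞ V) :
    Continuous (fun q : ℝ × E => Φ q.1 q.2) := (hΦ.contDiff hV).continuous

theorem contDiff_apply (hΦ : IsFlow V Φ) (hV : ContDiff ℝ ∞ V) (t : ℝ) : ContDiff ℝ ∞ (Φ t) :=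
  (hΦ.contDiff hV).comp (contDiff_const.prodMk contDiff_id)

/-- During a bounded time interval only a compact set of points visits a given compact set. -/
theorem exists_isCompact (hΦ : IsFlow V Φ) (hV : ContDiff ℝ ∞ V) {K : Set E} (hK : IsCompact K)
    (a b : ℝ) : ∃ K' : Set E, IsCompact K' ∧ ∀ t ∈ Icc a b, ∀ z, Φ t z ∈ K → z ∈ K' := by
  refine ⟨(fun q : ℝ × E => Φ (-q.1) q.2) '' (Icc a b ×ˢ K), (isCompact_Icc.prod hK).image
    ((hΦ.continuous hV).comp (continuous_fst.neg.prodMk continuous_snd)), fun t ht z hz => ?_⟩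
  exact ⟨(t, Φ t z), ⟨ht, hz⟩, hΦ.neg_apply (hV.of_le (by exact_mod_cast le_top)) t z⟩

theorem hasCompactSupport_comp (hΦ : IsFlow V Φ) (hV : ContDiff ℝ ∞ V) {g : E → ℝ}
    (hg : HasCompactSupport g) (t : ℝ) : HasCompactSupport fun z => g (Φ t z) := by
  obtain ⟨K', hK', h⟩ := hΦ.exists_isCompact hV hg.isCompact t t
  exact HasCompactSupport.of_support_subset_isCompact hK'
    fun z hz => h t (by simp) z (subset_tsupport _ hz)

variable [MeasurableSpace E] [BorelSpace E]

theorem continuous_integral_comp (hΦ : IsFlow V Φ) (hV : ContDiff ℝ ∞ V) (μ : Measure E)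
    [IsFiniteMeasureOnCompacts μ] {g : ℝ × E → ℝ} (hg : Continuous g) {K : Set E}
    (hK : IsCompact K) (hgK : ∀ t, ∀ z ∉ K, g (t, z) = 0) :
    Continuous fun t => ∫ z, g (t, Φ t z) ∂μ := by
  refine continuous_iff_continuousAt.2 fun t₀ => ?_
  obtain ⟨K', hK', hKK'⟩ := hΦ.exists_isCompact hV hK (t₀ - 1) (t₀ + 1)
  have hc : Continuous (fun t => ∫ z in K', g (t, Φ t z) ∂μ) :=
    continuous_parametric_integral_of_continuous (f := fun t z => g (t, Φ t z))
      (hg.comp (continuous_fst.prodMk (hΦ.continuous hV))) hK'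
  refine hc.continuousAt.congr ?_
  filter_upwards [Icc_mem_nhds (sub_one_lt t₀) (lt_add_one t₀)] with t ht
  exact setIntegral_eq_integral_of_forall_compl_eq_zero fun z hz =>
    hgK t _ fun h => hz (hKK' t ht z h)

theorem hasDerivAt_integral_comp (hΦ : IsFlow V Φ) (hV : ContDiff ℝ ∞ V) (μ : Measure E)
    [IsFiniteMeasureOnCompacts μ] {g : ℝ × E → ℝ} (hg : ContDiff ℝ 1 g) {K : Set E}
    (hK : IsCompact K) (hgK : ∀ t, ∀ z ∉ K, g (t, z) = 0) (t₀ : ℝ) :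
    HasDerivAt (fun t => ∫ z, g (t, Φ t z) ∂μ)
      (∫ z, fderiv ℝ g (t₀, Φ t₀ z) (1, V (Φ t₀ z)) ∂μ) t₀ := by
  obtain ⟨K', hK', hKK'⟩ := hΦ.exists_isCompact hV hK (t₀ - 1) (t₀ + 1)
  have hΦc := hΦ.continuous hV
  have hzero : ∀ t ∈ Icc (t₀ - 1) (t₀ + 1), ∀ z ∉ K', g (t, Φ t z) = 0 :=
    fun t ht z hz => hgK t _ fun h => hz (hKK' t ht z h)
  have hsupp : ∀ t ∈ Icc (t₀ - 1) (t₀ + 1), Function.support (fun z => g (t, Φ t z)) ⊆ K' :=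
    fun t ht z hz => by_contra fun h => hz (hzero t ht z h)
  have hct : ∀ t, Continuous fun z => g (t, Φ t z) := fun t =>
    hg.continuous.comp (continuous_const.prodMk (hΦc.comp (continuous_const.prodMk continuous_id)))
  have hD : Continuous fun q : ℝ × E => fderiv ℝ g (q.1, Φ q.1 q.2) (1, V (Φ q.1 q.2)) :=
    ((hg.continuous_fderiv one_ne_zero).comp (continuous_fst.prodMk hΦc)).clm_apply
      (continuous_const.prodMk (hV.continuous.comp hΦc))
  obtain ⟨C, hC⟩ := (isCompact_Icc.prod hK').exists_bound_of_continuousOn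
    (s := Icc (t₀ - 1) (t₀ + 1) ×ˢ K') hD.continuousOn
  have ht₀ : t₀ ∈ Icc (t₀ - 1) (t₀ + 1) := by constructor <;> linarith
  refine (hasDerivAt_integral_of_dominated_loc_of_deriv_le
    (bound := K'.indicator fun _ => C) (s := Ioo (t₀ - 1) (t₀ + 1))
    (F' := fun t z => fderiv ℝ g (t, Φ t z) (1, V (Φ t z)))
    (Ioo_mem_nhds (sub_one_lt t₀) (lt_add_one t₀))
    (Eventually.of_forall fun t => (hct t).aestronglyMeasurable)
    ((hct t₀).integrable_of_hasCompactSupport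
      (HasCompactSupport.of_support_subset_isCompact hK' (hsupp t₀ ht₀)))
    (hD.comp (continuous_const.prodMk continuous_id)).aestronglyMeasurable
    (Eventually.of_forall fun z t ht => ?_)
    ((integrable_indicator_iff hK'.measurableSet).2
      (continuous_const.continuousOn.integrableOn_compact hK'))
    (Eventually.of_forall fun z t _ => hΦ.hasDerivAt_comp (hg.differentiable one_ne_zero _))).2
  by_cases hz : z ∈ K'
  · rw [indicator_of_mem hz]
    exact hC (t, z) ⟨Ioo_subset_Icc_self ht, hz⟩
  · rw [indicator_of_notMem hz]
    -- off `K'` the integrand vanishes near time `t`, hence so does its derivative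
    have h0 : HasDerivAt (fun s => g (s, Φ s z)) 0 t := by
      refine (hasDerivAt_const t (0 : ℝ)).congr_of_eventuallyEq ?_
      filter_upwards [Ioo_mem_nhds ht.1 ht.2] with s hs
      exact hzero s (Ioo_subset_Icc_self hs) z hz
    rw [(hΦ.hasDerivAt_comp (hg.differentiable one_ne_zero _)).unique h0, norm_zero]

end IsFlow

/-! ### Hamiltonian vector fields -/

section Hamiltonian

variable {d : ℕ} {H : Phase d → ℝ}

/-- The Hamiltonian vector field `(∇_p H, -∇_x H)`. -/
noncomputable def hamField (H : Phase d → ℝ) (z : Phase d) : Phase d := (gradP H z, -gradX H z)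

theorem contDiff_hamField (hH : ContDiff ℝ ∞ H) : ContDiff ℝ ∞ (hamField H) :=
  (contDiff_gradP hH).prodMk (contDiff_gradX hH).neg

theorem inner_gradX (hH : Differentiable ℝ H) (z : Phase d) (v : Cfg d) :
    inner ℝ (gradX H z) v = fderiv ℝ H z (v, 0) := by
  have h : HasFDerivAt (fun x => H (x, z.2))
      (fderiv ℝ H z ∘L ContinuousLinearMap.inl ℝ (Cfg d) (Cfg d)) z.1 :=
    (hH z).hasFDerivAt.comp z.1 (hasFDerivAt_prodMk_left z.1 z.2)
  rw [gradX, gradient, h.fderiv, InnerProductSpace.toDual_symm_apply]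
  rfl

theorem inner_gradP (hH : Differentiable ℝ H) (z : Phase d) (v : Cfg d) :
    inner ℝ (gradP H z) v = fderiv ℝ H z (0, v) := by
  have h : HasFDerivAt (fun p => H (z.1, p))
      (fderiv ℝ H z ∘L ContinuousLinearMap.inr ℝ (Cfg d) (Cfg d)) z.2 :=
    (hH z).hasFDerivAt.comp z.2 (hasFDerivAt_prodMk_right z.1 z.2)
  rw [gradP, gradient, h.fderiv, InnerProductSpace.toDual_symm_apply]
  rfl

theorem exists_isFlow (hflow : HasCompleteFlow H) : ∃ Φ, IsFlow (hamField H) Φ := by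
  choose γ h0 hγ using hflow
  exact ⟨fun t z => γ z t, h0, fun z t => hγ z t⟩

/-- Integrating by parts twice, the derivatives of two functions in two directions can be
interchanged under the integral, because second derivatives are symmetric. -/
theorem integral_fderiv_mul_fderiv_swap {E : Type*} [NormedAddCommGroup E] [NormedSpace ℝ E]
    [FiniteDimensional ℝ E] [MeasurableSpace E] [BorelSpace E] {μ : Measure E}
    [μ.IsAddHaarMeasure] {H k : E → ℝ} (hH : ContDiff ℝ ∞ H) (hk : ContDiff ℝ 1 k)
    (hkc : HasCompactSupport k) (v w : E) :
    ∫ z, fderiv ℝ H z v * fderiv ℝ k z w ∂μ = ∫ z, fderiv ℝ H z w * fderiv ℝ k z v ∂μ := by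
  have hH' : ContDiff ℝ ∞ (fderiv ℝ H) := hH.fderiv_right (by simp)
  have hHv : ∀ v, ContDiff ℝ ∞ fun z => fderiv ℝ H z v := fun v => hH'.clm_apply contDiff_const
  have hkv : ∀ v, Continuous fun z => fderiv ℝ k z v := fun v =>
    (hk.continuous_fderiv one_ne_zero).clm_apply continuous_const
  have hkvc : ∀ v, HasCompactSupport fun z => fderiv ℝ k z v := fun v =>
    hkc.fderiv_apply (𝕜 := ℝ) v
  have hD : ∀ v w, Continuous fun z => fderiv ℝ (fun z => fderiv ℝ H z v) z w := fun v w =>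
    ((hHv v).continuous_fderiv (by simp)).clm_apply continuous_const
  have key : ∀ v w, ∫ z, fderiv ℝ H z v * fderiv ℝ k z w ∂μ
      = - ∫ z, fderiv ℝ (fun z => fderiv ℝ H z v) z w * k z ∂μ := fun v w =>
    integral_mul_fderiv_eq_neg_fderiv_mul_of_integrable
      (((hD v w).mul hk.continuous).integrable_of_hasCompactSupport hkc.mul_left)
      (((hHv v).continuous.mul (hkv w)).integrable_of_hasCompactSupport (hkvc w).mul_left)
      (((hHv v).continuous.mul hk.continuous).integrable_of_hasCompactSupport hkc.mul_left)
      (fun z _ => ((hHv v).differentiable (by simp)) z)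
      (fun z _ => (hk.differentiable one_ne_zero) z)
  rw [key v w, key w v]
  congr 2
  funext z
  have hsymm : IsSymmSndFDerivAt ℝ H z := (hH.contDiffAt).isSymmSndFDerivAt (by
    rw [minSmoothness_of_isRCLikeNormedField]; exact ENat.LEInfty.out)
  have hdd : ∀ v w, fderiv ℝ (fun z => fderiv ℝ H z v) z w = fderiv ℝ (fderiv ℝ H) z w v := by
    intro v w
    rw [fderiv_clm_apply ((hH'.differentiable (by simp)) z) (differentiableAt_const v)]
    simp
  rw [hdd, hdd, hsymm.eq]

/-- The Hamiltonian vector field is divergence free, in weak form. -/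
theorem integral_fderiv_hamField (hH : ContDiff ℝ ∞ H) {k : Phase d → ℝ} (hk : ContDiff ℝ 1 k)
    (hkc : HasCompactSupport k) : ∫ z, fderiv ℝ k z (hamField H z) = 0 := by
  have hHd : Differentiable ℝ H := hH.differentiable (by simp)
  let e : Fin d → Cfg d := fun i => EuclideanSpace.single i 1
  have hdec : ∀ a : Cfg d, a = ∑ i, inner ℝ a (e i) • e i := fun a => by
    conv_lhs => rw [← (EuclideanSpace.basisFun (Fin d) ℝ).sum_repr' a]
    simp [e, real_inner_comm]
  have hpt : ∀ z, fderiv ℝ k z (hamField H z)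
      = ∑ i, (fderiv ℝ H z (0, e i) * fderiv ℝ k z (e i, 0)
        - fderiv ℝ H z (e i, 0) * fderiv ℝ k z (0, e i)) := by
    intro z
    have h1 : fderiv ℝ k z (gradP H z, 0)
        = ∑ i, fderiv ℝ H z (0, e i) * fderiv ℝ k z (e i, 0) := by
      have := congrArg (fderiv ℝ k z ∘L ContinuousLinearMap.inl ℝ (Cfg d) (Cfg d))
        (hdec (gradP H z))
      rw [map_sum] at this
      simpa [inner_gradP hHd] using this
    have h2 : fderiv ℝ k z (0, gradX H z)
        = ∑ i, fderiv ℝ H z (e i, 0) * fderiv ℝ k z (0, e i) := by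
      have := congrArg (fderiv ℝ k z ∘L ContinuousLinearMap.inr ℝ (Cfg d) (Cfg d))
        (hdec (gradX H z))
      rw [map_sum] at this
      simpa [inner_gradX hHd] using this
    rw [Finset.sum_sub_distrib, ← h1, ← h2, ← map_sub]
    simp [hamField]
  have hint : ∀ v w : Phase d, Integrable fun z => fderiv ℝ H z v * fderiv ℝ k z w := fun v w =>
    ((((hH.continuous_fderiv (by simp)).clm_apply continuous_const).mul
      ((hk.continuous_fderiv one_ne_zero).clm_apply
        continuous_const))).integrable_of_hasCompactSupport
      (hkc.fderiv_apply (𝕜 := ℝ) w).mul_left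
  simp_rw [hpt]
  have hsub : ∀ i, Integrable fun z => fderiv ℝ H z (0, e i) * fderiv ℝ k z (e i, 0)
      - fderiv ℝ H z (e i, 0) * fderiv ℝ k z (0, e i) := fun i => (hint _ _).sub (hint _ _)
  rw [integral_finsetSum _ fun i _ => hsub i]
  refine Finset.sum_eq_zero fun i _ => ?_
  rw [integral_sub (hint _ _) (hint _ _), sub_eq_zero]
  have : (volume : Measure (Phase d)).IsAddHaarMeasure :=
    inferInstanceAs ((volume : Measure (Cfg d)).prod volume).IsAddHaarMeasure
  exact integral_fderiv_mul_fderiv_swap (μ := (volume : Measure (Phase d))) hH hk hkc _ _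

/-- Liouville's theorem: the Hamiltonian flow preserves phase-space integrals. The time derivative
of `∫ k ∘ Φ_t` is the integral of the derivative of `k ∘ Φ_t` along the divergence-free field. -/
theorem integral_comp_hamFlow (hH : ContDiff ℝ ∞ H) {Φ : ℝ → Phase d → Phase d}
    (hΦ : IsFlow (hamField H) Φ) {k : Phase d → ℝ} (hk : ContDiff ℝ 1 k)
    (hkc : HasCompactSupport k) (t : ℝ) : ∫ z, k (Φ t z) = ∫ z, k z := by
  have hV := contDiff_hamField hH
  have hV1 : ContDiff ℝ 1 (hamField H) := hV.of_le (by exact_mod_cast le_top)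
  have hd : ∀ t, HasDerivAt (fun t => ∫ z, k (Φ t z)) 0 t := by
    intro t
    have h := hΦ.hasDerivAt_integral_comp hV volume (g := fun q => k q.2) (hk.comp contDiff_snd)
      hkc.isCompact (fun _ z hz => image_eq_zero_of_notMem_tsupport hz) t
    have hkt : ContDiff ℝ 1 (k ∘ Φ t) :=
      hk.comp ((hΦ.contDiff_apply hV t).of_le (by exact_mod_cast le_top))
    have hktc : HasCompactSupport (k ∘ Φ t) := hΦ.hasCompactSupport_comp hV hkc t
    convert! h using 1
    rw [← integral_fderiv_hamField hH hkt hktc]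
    congr 1
    funext z
    -- both sides are the derivative at `s = 0` of `k (Φ (s + t) z) = (k ∘ Φ t) (Φ s z)`
    have h1 : HasDerivAt (fun s => (k ∘ Φ t) (Φ s z)) (fderiv ℝ (k ∘ Φ t) z (hamField H z)) 0 := by
      have := ((hkt.differentiable one_ne_zero) (Φ 0 z)).hasFDerivAt.comp_hasDerivAt 0
        (hΦ.hasDerivAt z 0)
      simpa [hΦ.zero, Function.comp_def] using this
    have h2 := hΦ.hasDerivAt_comp (g := fun q => k q.2) (t := t + 0) (z := z)
      ((hk.comp contDiff_snd).differentiable one_ne_zero _)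
    have h3 := h2.comp_const_add t 0
    simp only [hΦ.add hV1 t, add_zero] at h3
    exact h1.unique h3
  have hconst := is_const_of_deriv_eq_zero (fun t => (hd t).differentiableAt)
    (fun t => (hd t).deriv) t 0
  simpa [hΦ.zero] using hconst

end Hamiltonian

variable {d : ℕ} {H : Phase d → ℝ} {Φ : ℝ → Phase d → Phase d} {u₀ : Cfg d → Cfg d}

/-! ### Level-set functions -/

/-- The Liouville operator of the definition of level-set functions is the total derivative in the
direction `(1, ∇_p H, -∇_x H)`. -/
theorem liouville_eq_fderiv {φ : ℝ → Phase d → Cfg d} {t : ℝ} {x p : Cfg d}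
    (h : DifferentiableAt ℝ (fun q : ℝ × Phase d => φ q.1 q.2) (t, (x, p))) :
    deriv (fun s => φ s (x, p)) t
      + fderiv ℝ (fun y => φ t (y, p)) x (gradP H (x, p))
      - fderiv ℝ (fun q => φ t (x, q)) p (gradX H (x, p))
    = fderiv ℝ (fun q : ℝ × Phase d => φ q.1 q.2) (t, (x, p)) (1, hamField H (x, p)) := by
  set L := fderiv ℝ (fun q : ℝ × Phase d => φ q.1 q.2) (t, (x, p))
  have h1 : HasDerivAt (fun s => φ s (x, p)) (L (1, 0)) t :=
    HasFDerivAt.comp_hasDerivAt (f := fun s : ℝ => (s, (x, p))) t h.hasFDerivAt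
      ((hasDerivAt_id' t).prodMk (hasDerivAt_const t (x, p)))
  have h2 : HasFDerivAt (fun y => φ t (y, p)) (L ∘L .inr ℝ ℝ (Phase d) ∘L .inl ℝ _ _) x :=
    HasFDerivAt.comp (f := fun y : Cfg d => (t, (y, p))) x h.hasFDerivAt
      ((hasFDerivAt_prodMk_right t (x, p)).comp x (hasFDerivAt_prodMk_left x p))
  have h3 : HasFDerivAt (fun q => φ t (x, q)) (L ∘L .inr ℝ ℝ (Phase d) ∘L .inr ℝ _ _) p :=
    HasFDerivAt.comp (f := fun q : Cfg d => (t, (x, q))) p h.hasFDerivAt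
      ((hasFDerivAt_prodMk_right t (x, p)).comp p (hasFDerivAt_prodMk_right x p))
  rw [h1.deriv, h2.fderiv, h3.fderiv]
  simp only [ContinuousLinearMap.comp_apply, ContinuousLinearMap.inr_apply,
    ContinuousLinearMap.inl_apply, ← map_add, ← map_sub]
  simp [hamField]

theorem isLevelSetFunction_comp_flow (hH : ContDiff ℝ ∞ H) (hΦ : IsFlow (hamField H) Φ)
    (hu₀ : ContDiff ℝ 1 u₀) :
    IsLevelSetFunction H u₀ fun t z => (Φ (-t) z).2 - u₀ (Φ (-t) z).1 := by
  have hV := contDiff_hamField hH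
  have hV1 : ContDiff ℝ 1 (hamField H) := hV.of_le (by exact_mod_cast le_top)
  have hΦs : ContDiff ℝ 1 fun q : ℝ × Phase d => Φ (-q.1) q.2 :=
    ((hΦ.contDiff hV).of_le (by exact_mod_cast le_top)).comp
      (contDiff_fst.neg.prodMk contDiff_snd)
  have hF : ContDiff ℝ 1 fun q : ℝ × Phase d => (Φ (-q.1) q.2).2 - u₀ (Φ (-q.1) q.2).1 :=
    (contDiff_snd.comp hΦs).sub (hu₀.comp (contDiff_fst.comp hΦs))
  refine ⟨hF.continuous.continuousOn, hF.contDiffOn, fun t _ x p => ?_, fun x p => ?_⟩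
  · rw [liouville_eq_fderiv (φ := fun t z => (Φ (-t) z).2 - u₀ (Φ (-t) z).1)
      (hF.differentiable one_ne_zero _)]
    have h := hΦ.hasDerivAt_comp (t := t) (z := Φ (-t) (x, p)) (hF.differentiable one_ne_zero _)
    simp only [hΦ.neg_apply hV1, hΦ.apply_neg hV1] at h
    exact h.unique (hasDerivAt_const _ _)
  · simp [hΦ.zero]

/-- A level-set function is constant along the bicharacteristics. -/
theorem IsLevelSetFunction.apply_flow {φ : ℝ → Phase d → Cfg d}
    (hφ : IsLevelSetFunction H u₀ φ) (hΦ : IsFlow (hamField H) Φ) {t : ℝ} (ht : 0 ≤ t)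
    (z : Phase d) : φ t (Φ t z) = z.2 - u₀ z.1 := by
  have h0 : φ 0 (Φ 0 z) = z.2 - u₀ z.1 := by rw [hΦ.zero]; exact hφ.initial z.1 z.2
  rw [← h0]
  rcases ht.eq_or_lt with rfl | ht
  · rfl
  ext i
  have hc : ContinuousOn (fun s => φ s (Φ s z)) (Icc 0 t) :=
    hφ.continuousOn.comp (f := fun s => (s, Φ s z))
      (continuous_id.prodMk (hΦ.continuous_time z)).continuousOn fun s hs => ⟨hs.1, mem_univ _⟩
  have hd : ∀ s ∈ Ioo 0 t, HasDerivAt (fun s => φ s (Φ s z)) 0 s := by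
    intro s hs
    have hdiff : DifferentiableAt ℝ (fun q : ℝ × Phase d => φ q.1 q.2) (s, Φ s z) :=
      (hφ.contDiffOn.differentiableOn one_ne_zero).differentiableAt
        ((isOpen_Ioi.prod isOpen_univ).mem_nhds ⟨hs.1, mem_univ _⟩)
    have h := hΦ.hasDerivAt_comp hdiff
    rwa [← liouville_eq_fderiv (H := H) hdiff, hφ.equation s hs.1] at h
  obtain ⟨c, hc', hslope⟩ := exists_hasDerivAt_eq_slope (fun s => φ s (Φ s z) i) (fun _ => 0) ht
    ((EuclideanSpace.proj (𝕜 := ℝ) i).continuous.comp_continuousOn hc)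
    (fun s hs => by
      simpa [Function.comp_def] using
        (EuclideanSpace.proj (𝕜 := ℝ) i).hasFDerivAt.comp_hasDerivAt s (hd s hs))
  rw [eq_comm, div_eq_zero_iff] at hslope
  rcases hslope with h | h
  · exact sub_eq_zero.1 h
  · linarith

theorem IsLevelSetFunction.eq_comp_flow {φ : ℝ → Phase d → Cfg d}
    (hφ : IsLevelSetFunction H u₀ φ) (hH : ContDiff ℝ ∞ H) (hΦ : IsFlow (hamField H) Φ) {t : ℝ}
    (ht : 0 ≤ t) (z : Phase d) : φ t z = (Φ (-t) z).2 - u₀ (Φ (-t) z).1 := by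
  rw [← hφ.apply_flow hΦ ht,
    hΦ.apply_neg ((contDiff_hamField hH).of_le (by exact_mod_cast le_top))]

/-! ### The delta distribution of a level-set function -/

/-- Rescaling the momentum around the graph of `u₀`. -/
theorem integral_mollifier (hu₀ : Continuous u₀) {η : Cfg d → ℝ} (hη : Continuous η)
    {G : Phase d → ℝ} (hG : Continuous G) (hGc : HasCompactSupport G) {ε : ℝ}
    (hε : 0 < ε) :
    ∫ z : Phase d, (ε ^ d)⁻¹ * η (ε⁻¹ • (z.2 - u₀ z.1)) * G z
      = ∫ x, ∫ q, η q * G (x, u₀ x + ε • q) := by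
  have hcont : Continuous fun z : Phase d => (ε ^ d)⁻¹ * η (ε⁻¹ • (z.2 - u₀ z.1)) * G z := by
    fun_prop
  have hint := hcont.integrable_of_hasCompactSupport (μ := (volume : Measure (Cfg d)).prod volume)
    hGc.mul_left
  rw [Measure.volume_eq_prod, integral_prod _ hint]
  congr 1
  funext x
  rw [← integral_add_left_eq_self _ (u₀ x)]
  have h := Measure.integral_comp_smul (volume : Measure (Cfg d))
    (fun q => η (ε⁻¹ • q) * G (x, u₀ x + q)) ε
  simp only [smul_smul, inv_mul_cancel₀ hε.ne', one_smul] at h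
  rw [h, finrank_euclideanSpace_fin, abs_of_nonneg (by positivity), smul_eq_mul,
    ← integral_const_mul]
  simp [mul_assoc]

theorem tendsto_integral_mollifier (hu₀ : Continuous u₀) {η : Cfg d → ℝ} (hη : Continuous η)
    (hηc : HasCompactSupport η) (hη1 : ∫ q, η q = 1) {G : Phase d → ℝ} (hG : Continuous G)
    (hGc : HasCompactSupport G) :
    Tendsto (fun ε : ℝ => ∫ z : Phase d, (ε ^ d)⁻¹ * η (ε⁻¹ • (z.2 - u₀ z.1)) * G z) (𝓝[>] 0)
      (𝓝 (∫ x, G (x, u₀ x))) := by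
  let K : Set (Phase d) := (Prod.fst '' tsupport G) ×ˢ tsupport η
  have hK : IsCompact K := (hGc.isCompact.image continuous_fst).prod hηc.isCompact
  have hcont : Continuous fun q : ℝ × Phase d => η q.2.2 * G (q.2.1, u₀ q.2.1 + q.1 • q.2.2) := by
    fun_prop
  have hzero : ∀ ε : ℝ, ∀ z ∉ K, η z.2 * G (z.1, u₀ z.1 + ε • z.2) = 0 := by
    intro ε z hz
    by_contra h
    exact hz ⟨⟨_, subset_tsupport _ (right_ne_zero_of_mul h), rfl⟩,
      subset_tsupport _ (left_ne_zero_of_mul h)⟩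
  have hJ : Continuous fun ε : ℝ => ∫ z in K, η z.2 * G (z.1, u₀ z.1 + ε • z.2) :=
    continuous_parametric_integral_of_continuous
      (f := fun (ε : ℝ) (z : Phase d) => η z.2 * G (z.1, u₀ z.1 + ε • z.2)) hcont hK
  have hJeq : ∀ ε : ℝ, ∫ z in K, η z.2 * G (z.1, u₀ z.1 + ε • z.2)
      = ∫ x, ∫ q, η q * G (x, u₀ x + ε • q) := by
    intro ε
    have hc : Continuous fun z : Phase d => η z.2 * G (z.1, u₀ z.1 + ε • z.2) :=
      hcont.comp (continuous_const.prodMk continuous_id)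
    rw [setIntegral_eq_integral_of_forall_compl_eq_zero (hzero ε), Measure.volume_eq_prod,
      integral_prod _ (hc.integrable_of_hasCompactSupport
        (HasCompactSupport.of_support_subset_isCompact hK
          fun z hz => by_contra fun h => hz (hzero ε z h)))]
  have hlim := (hJ.tendsto 0).mono_left (nhdsWithin_le_nhds (s := Ioi 0))
  have h0 : ∫ z in K, η z.2 * G (z.1, u₀ z.1 + (0 : ℝ) • z.2) = ∫ x, G (x, u₀ x) := by
    rw [hJeq]
    simp [integral_mul_const, hη1]
  rw [h0] at hlim
  refine hlim.congr' ?_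
  filter_upwards [self_mem_nhdsWithin] with ε hε
  rw [hJeq, integral_mollifier hu₀ hη hG hGc hε]

/-- Since the flow preserves phase-space volume, `δ(φ(t))` is the image under `Φ_t` of the measure
carried by the graph of `u₀`. -/
theorem isDeltaComp_comp_flow (hH : ContDiff ℝ ∞ H) (hΦ : IsFlow (hamField H) Φ)
    (hu₀ : ContDiff ℝ 1 u₀) (t : ℝ) {T : PhaseDistribution d}
    (hT : ∀ g : PhaseTest d, T g = ∫ x, g (Φ t (x, u₀ x))) :
    IsDeltaComp (fun z => (Φ (-t) z).2 - u₀ (Φ (-t) z).1) T := by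
  intro η hη hηc hη1 g
  have hV := contDiff_hamField hH
  have hV1 : ContDiff ℝ 1 (hamField H) := hV.of_le (by exact_mod_cast le_top)
  rw [hT g]
  refine (tendsto_integral_mollifier hu₀.continuous hη.continuous hηc hη1
    (g.continuous.comp (hΦ.contDiff_apply hV t).continuous)
    (hΦ.hasCompactSupport_comp hV g.hasCompactSupport t)).congr fun ε => ?_
  have hw : ContDiff ℝ 1 fun z => (Φ (-t) z).2 - u₀ (Φ (-t) z).1 := by
    have h : ContDiff ℝ 1 (Φ (-t)) :=
      (hΦ.contDiff_apply hV (-t)).of_le (by exact_mod_cast le_top)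
    exact (contDiff_snd.comp h).sub (hu₀.comp (contDiff_fst.comp h))
  have hk : ContDiff ℝ 1 fun z : Phase d =>
      (ε ^ d)⁻¹ * η (ε⁻¹ • ((Φ (-t) z).2 - u₀ (Φ (-t) z).1)) * g z :=
    (contDiff_const.mul ((hη.of_le (by exact_mod_cast le_top)).comp (hw.const_smul ε⁻¹))).mul
      (g.contDiff.of_le (by exact_mod_cast le_top))
  rw [← integral_comp_hamFlow hH hΦ hk g.hasCompactSupport.mul_left t]
  simp only [hΦ.neg_apply hV1]
  rfl

/-! ### Transported measures solve the Liouville equation -/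

/-- Integration against a measure which is finite on compact sets, as a distribution. -/
noncomputable def measureDistribution (μ : Measure (Phase d)) : PhaseDistribution d :=
  ContinuousLinearMap.toUniformConvergenceCLM (RingHom.id ℝ) ℝ {S | IsCompact S}
    (TestFunction.integralAgainstBilinCLM (ContinuousLinearMap.mul ℝ ℝ) μ fun _ => (1 : ℝ))

theorem measureDistribution_apply (μ : Measure (Phase d)) [IsFiniteMeasureOnCompacts μ]
    (g : PhaseTest d) : measureDistribution μ g = ∫ z, g z ∂μ := by
  have h : LocallyIntegrableOn (fun _ : Phase d => (1 : ℝ)) (⊤ : Opens (Phase d)) μ :=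
    (locallyIntegrable_const 1).locallyIntegrableOn _
  refine (TestFunction.integralAgainstBilinCLM_eq_integral h).trans ?_
  simp

/-- The measure on phase space carried by the graph of `u₀`. -/
noncomputable def graphMeasure (u₀ : Cfg d → Cfg d) : Measure (Phase d) :=
  Measure.map (fun x => (x, u₀ x)) volume

theorem isFiniteMeasureOnCompacts_graphMeasure (hu₀ : Continuous u₀) :
    IsFiniteMeasureOnCompacts (graphMeasure u₀) where
  lt_top_of_isCompact K hK := by
    rw [graphMeasure, Measure.map_apply (by fun_prop) hK.measurableSet]
    have hsub : (fun x => (x, u₀ x)) ⁻¹' K ⊆ Prod.fst '' K := fun x hx => ⟨_, hx, rfl⟩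
    exact (measure_mono hsub).trans_lt (hK.image continuous_fst).measure_lt_top

theorem integral_graphMeasure (hu₀ : Continuous u₀) {g : Phase d → ℝ} (hg : Continuous g) :
    ∫ z, g z ∂(graphMeasure u₀) = ∫ x, g (x, u₀ x) :=
  integral_map (by fun_prop) hg.aestronglyMeasurable

theorem IsFlow.isFiniteMeasureOnCompacts_map {E : Type} [NormedAddCommGroup E] [NormedSpace ℝ E]
    [ProperSpace E] [MeasurableSpace E] [BorelSpace E] {V : E → E} {Φ : ℝ → E → E}
    (hΦ : IsFlow V Φ) (hV : ContDiff ℝ ∞ V) (μ : Measure E) [IsFiniteMeasureOnCompacts μ] (t : ℝ) :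
    IsFiniteMeasureOnCompacts (μ.map (Φ t)) where
  lt_top_of_isCompact K hK := by
    obtain ⟨K', hK', h⟩ := hΦ.exists_isCompact hV hK t t
    rw [Measure.map_apply (hΦ.contDiff_apply hV t).continuous.measurable hK.measurableSet]
    exact (measure_mono fun z hz => h t (by simp) z hz).trans_lt hK'.measure_lt_top

theorem measureDistribution_map_apply (hΦ : IsFlow (hamField H) Φ) (hH : ContDiff ℝ ∞ H)
    (μ : Measure (Phase d)) [IsFiniteMeasureOnCompacts μ] (t : ℝ) (g : PhaseTest d) :
    measureDistribution (μ.map (Φ t)) g = ∫ z, g (Φ t z) ∂μ := by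
  have hV := contDiff_hamField hH
  have := hΦ.isFiniteMeasureOnCompacts_map hV μ t
  rw [measureDistribution_apply]
  exact integral_map (hΦ.contDiff_apply hV t).continuous.measurable.aemeasurable
    g.continuous.aestronglyMeasurable

theorem isLiouvilleSolution_of_transport (hH : ContDiff ℝ ∞ H) (hΦ : IsFlow (hamField H) Φ)
    (μ : Measure (Phase d)) [IsFiniteMeasureOnCompacts μ] {ψ : ℝ → PhaseDistribution d}
    (hψ : ∀ t, 0 ≤ t → ∀ h : PhaseTest d, ψ t h = ∫ z, h (Φ t z) ∂μ) :
    IsLiouvilleSolution H hH (fun h => ∫ z, h z ∂μ) ψ := by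
  have hV := contDiff_hamField hH
  -- the pairing with a space-time test function is continuous and vanishes for large times
  have hcont : ∀ g : SpaceTimeTest d, Continuous fun t => ∫ z, g (t, Φ t z) ∂μ := fun g =>
    hΦ.continuous_integral_comp hV μ g.continuous (g.hasCompactSupport.isCompact.image
      continuous_snd) fun t z hz => by_contra fun h => hz ⟨_, subset_tsupport _ h, rfl⟩
  have hsupp : ∀ g : SpaceTimeTest d, HasCompactSupport fun t => ∫ z, g (t, Φ t z) ∂μ := by
    intro g
    refine HasCompactSupport.of_support_subset_isCompact
      (g.hasCompactSupport.isCompact.image continuous_fst) fun t ht => ?_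
    by_contra h
    refine ht (integral_eq_zero_of_ae (Eventually.of_forall fun z => ?_))
    by_contra h'
    exact h ⟨_, subset_tsupport _ h', rfl⟩
  have hint : ∀ g : SpaceTimeTest d, IntegrableOn (fun t => ∫ z, g (t, Φ t z) ∂μ) (Ioi 0) :=
    fun g => ((hcont g).integrable_of_hasCompactSupport (hsupp g)).integrableOn
  refine ⟨fun h => ?_, fun h => ?_, fun g => ?_, fun g => ?_⟩
  · simp [hψ 0 le_rfl, hΦ.zero]
  · refine (hΦ.continuous_integral_comp hV μ (g := fun q => h q.2)
      (h.continuous.comp continuous_snd) h.hasCompactSupport.isCompact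
      fun _ z hz => image_eq_zero_of_notMem_tsupport hz).continuousOn.congr fun t ht => hψ t ht h
  · exact (hint g).congr_fun (fun t ht => (hψ t (le_of_lt ht) (timeSlice g t)).symm) measurableSet_Ioi
  · have hd := hΦ.hasDerivAt_integral_comp hV μ (g := g) (g.contDiff.of_le (by exact_mod_cast le_top))
      (g.hasCompactSupport.isCompact.image continuous_snd)
      fun t z hz => by_contra fun h => hz ⟨_, subset_tsupport _ h, rfl⟩
    have hlim : Tendsto (fun t => ∫ z, g (t, Φ t z) ∂μ) atTop (𝓝 0) := by
      have h := (hsupp g).is_zero_at_infty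
      rw [cocompact_eq_atBot_atTop] at h
      exact h.mono_left le_sup_right
    have hFTC := integral_Ioi_of_hasDerivAt_of_tendsto (a := 0)
      (hcont g).continuousAt.continuousWithinAt (fun t _ => hd t) (hint (liouvilleTest H hH g)) hlim
    rw [setIntegral_congr_fun measurableSet_Ioi
      (g := fun t => ∫ z, fderiv ℝ g (t, Φ t z) (1, hamField H (Φ t z)) ∂μ)
      (fun t ht => hψ t (le_of_lt ht) _), hFTC]
    simp only [hΦ.zero, zero_sub]
    exact neg_add_cancel _

theorem IsLiouvilleSolution.const_mul_sum {ι : Type*} [Fintype ι] {hH : ContDiff ℝ ∞ H}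
    {ψ₀ : ι → PhaseTest d → ℝ} {ψ : ι → ℝ → PhaseDistribution d}
    (h : ∀ k, IsLiouvilleSolution H hH (ψ₀ k) (ψ k)) (c : ℝ) :
    IsLiouvilleSolution H hH (fun g => c * ∑ k, ψ₀ k g) fun t => c • ∑ k, ψ k t := by
  have happ : ∀ t g, (c • ∑ k, ψ k t) g = c * ∑ k, ψ k t g := by
    intro t g
    rw [smul_apply, sum_apply, smul_eq_mul]
  refine ⟨fun g => ?_, fun g => ?_, fun g => ?_, fun g => ?_⟩
  · rw [happ]; simp [(h _).initial]
  · simp only [happ]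
    exact continuousOn_const.mul (continuousOn_finsetSum _ fun k _ => (h k).continuousOn g)
  · simp only [happ]
    exact (integrable_finsetSum _ fun k _ => (h k).integrableOn g).const_mul c
  · simp only [happ]
    rw [integral_const_mul, integral_finsetSum _ fun k _ => (h k).integrableOn _, ← mul_add,
      ← Finset.sum_add_distrib, Finset.sum_eq_zero fun k _ => (h k).weak g, mul_zero]

theorem IsLiouvilleSolution.congr {hH : ContDiff ℝ ∞ H} {ψ₀ : PhaseTest d → ℝ}
    {ψ ψ' : ℝ → PhaseDistribution d} (h : IsLiouvilleSolution H hH ψ₀ ψ)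
    (hψ : ∀ t, 0 ≤ t → ψ' t = ψ t) : IsLiouvilleSolution H hH ψ₀ ψ' := by
  refine ⟨fun g => ?_, fun g => ?_, fun g => ?_, fun g => ?_⟩
  · rw [hψ 0 le_rfl, h.initial]
  · exact (h.continuousOn g).congr fun t ht => by rw [hψ t ht]
  · exact (h.integrableOn g).congr_fun (fun t ht => by simp only [hψ t (le_of_lt ht)])
      measurableSet_Ioi
  · rw [setIntegral_congr_fun measurableSet_Ioi
      (g := fun t => ψ t (timeSlice (liouvilleTest H hH g) t))
      fun t ht => by simp only [hψ t (le_of_lt ht)]]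
    exact h.weak g

/-! ### Uniqueness for the Liouville equation -/

section Duhamel

variable {E : Type} [NormedAddCommGroup E] [NormedSpace ℝ E] {V : E → E} {Φ : ℝ → E → E}

/-- Duhamel's formula for the solution of `(∂_t + V · ∇) G = θ h` that vanishes at late times. -/
noncomputable def duhamel (Φ : ℝ → E → E) (θ : ℝ → ℝ) (h : E → ℝ) (q : ℝ × E) : ℝ :=
  -∫ r in Ioi (0 : ℝ), θ (q.1 + r) * h (Φ r q.2)

theorem contDiff_duhamel [ProperSpace E] (hΦ : IsFlow V Φ) (hV : ContDiff ℝ ∞ V) {θ : ℝ → ℝ}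
    (hθ : ContDiff ℝ ∞ θ) (hθc : HasCompactSupport θ) {h : E → ℝ} (hh : ContDiff ℝ ∞ h) :
    ContDiff ℝ ∞ (duhamel Φ θ h) := by
  refine ContDiff.neg (contDiff_iff_contDiffAt.2 fun ⟨t₀, z₀⟩ => ?_)
  obtain ⟨A, hA⟩ := hθc.isCompact.isBounded.subset_closedBall (0 : ℝ)
  let s : Set (ℝ × E) := Ioo (t₀ - 1) (t₀ + 1) ×ˢ univ
  have hs : IsOpen s := isOpen_Ioo.prod isOpen_univ
  -- the integral is the value at `0` of a convolution with the Heaviside function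
  have hconv := contDiffOn_convolution_right_with_param (𝕜 := ℝ) (n := ⊤)
    (f := (Ioi (0 : ℝ)).indicator fun _ => (1 : ℝ)) (μ := volume) (ContinuousLinearMap.mul ℝ ℝ)
    (g := fun (q : ℝ × E) (y : ℝ) => θ (q.1 - y) * h (Φ (-y) q.2)) hs
    (isCompact_Icc (a := t₀ - 1 - A) (b := t₀ + 1 + A))
    (fun q y hq hy => by
      refine mul_eq_zero_of_left (image_eq_zero_of_notMem_tsupport fun hmem => hy ?_) _
      have h1 := hA hmem
      rw [Metric.mem_closedBall, dist_zero_right, Real.norm_eq_abs, abs_le] at h1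
      have h2 := hq.1
      constructor <;> linarith [h1.1, h1.2, h2.1, h2.2])
    ((locallyIntegrable_const 1).indicator measurableSet_Ioi)
    (by
      refine ContDiff.contDiffOn ?_
      refine (hθ.comp ((contDiff_fst.comp contDiff_fst).sub contDiff_snd)).mul (hh.comp ?_)
      exact (hΦ.contDiff hV).comp (contDiff_snd.neg.prodMk (contDiff_snd.comp contDiff_fst)))
  have hat := hconv.contDiffAt ((hs.prod isOpen_univ).mem_nhds
    (show ((t₀, z₀), (0 : ℝ)) ∈ s ×ˢ univ from ⟨⟨by constructor <;> linarith, trivial⟩, trivial⟩))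
  have := hat.comp (t₀, z₀) (contDiffAt_id.prodMk (contDiffAt_const (c := (0 : ℝ))))
  refine this.congr_of_eventuallyEq (Eventually.of_forall fun q => ?_)
  simp only [Function.comp_apply, convolution, id]
  rw [← integral_indicator measurableSet_Ioi]
  congr 1
  funext r
  by_cases hr : r ∈ Ioi (0 : ℝ) <;> simp [hr]

theorem duhamel_apply_flow (hΦ : IsFlow V Φ) (hV : ContDiff ℝ 1 V) (θ : ℝ → ℝ) (h : E → ℝ)
    (s : ℝ) (z : E) : duhamel Φ θ h (s, Φ s z) = -∫ r in Ioi s, θ r * h (Φ r z) := by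
  rw [duhamel]
  simp only [← hΦ.add hV]
  rw [← integral_indicator measurableSet_Ioi, ← integral_indicator measurableSet_Ioi,
    ← integral_add_right_eq_self ((Ioi s).indicator _) s]
  congr 2
  funext r
  simp [indicator, add_comm]

theorem fderiv_duhamel [ProperSpace E] (hΦ : IsFlow V Φ) (hV : ContDiff ℝ ∞ V) {θ : ℝ → ℝ}
    (hθ : ContDiff ℝ ∞ θ) (hθc : HasCompactSupport θ) {h : E → ℝ} (hh : ContDiff ℝ ∞ h) (t : ℝ)
    (z : E) : fderiv ℝ (duhamel Φ θ h) (t, z) (1, V z) = θ t * h z := by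
  have hV1 : ContDiff ℝ 1 V := hV.of_le (by exact_mod_cast le_top)
  have h1 := hΦ.hasDerivAt_comp (t := t) (z := Φ (-t) z)
    ((contDiff_duhamel hΦ hV hθ hθc hh).differentiable (by simp) _)
  simp only [duhamel_apply_flow hΦ hV1, hΦ.apply_neg hV1] at h1
  set y := Φ (-t) z
  have hm : Continuous fun r => θ r * h (Φ r y) :=
    hθ.continuous.mul (hh.continuous.comp (hΦ.continuous_time y))
  have hmi : Integrable fun r => θ r * h (Φ r y) :=
    hm.integrable_of_hasCompactSupport hθc.mul_right
  have h2 : HasDerivAt (fun s => -∫ r in Ioi s, θ r * h (Φ r y)) (θ t * h (Φ t y)) t := by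
    have heq : (fun s => -∫ r in Ioi s, θ r * h (Φ r y))
        = fun s => (∫ r in (0 : ℝ)..s, θ r * h (Φ r y)) - ∫ r in Ioi 0, θ r * h (Φ r y) := by
      funext s
      have := intervalIntegral.integral_Ioi_sub_Ioi' (a := 0) (b := s) hmi.integrableOn
        hmi.integrableOn
      linarith
    rw [heq]
    exact (intervalIntegral.integral_hasDerivAt_right (hm.intervalIntegrable _ _)
      hm.aestronglyMeasurable.stronglyMeasurableAtFilter hm.continuousAt).sub_const _
  rw [h1.unique h2, hΦ.apply_neg hV1]

end Duhamel

/-- The adjoint problem with a product right-hand side is solvable in test functions. The Duhamel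
integral is cut off at negative times, where its values do not matter. -/
theorem exists_liouvilleTest_eq (hH : ContDiff ℝ ∞ H) (hΦ : IsFlow (hamField H) Φ) {θ : ℝ → ℝ}
    (hθ : ContDiff ℝ ∞ θ) (hθc : HasCompactSupport θ) (h : PhaseTest d) :
    ∃ g : SpaceTimeTest d, ∀ t, 0 < t → ∀ z, liouvilleTest H hH g (t, z) = θ t * h z := by
  have hV := contDiff_hamField hH
  have hh : ContDiff ℝ ∞ h := h.contDiff
  obtain ⟨A, hA⟩ := hθc.isCompact.isBounded.subset_closedBall (0 : ℝ)
  have hA' : ∀ t, A < t → θ t = 0 := fun t ht => image_eq_zero_of_notMem_tsupport fun hmem => by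
    have := hA hmem
    rw [Metric.mem_closedBall, dist_zero_right, Real.norm_eq_abs, abs_le] at this
    linarith [this.2]
  obtain ⟨K', hK', hKK'⟩ := hΦ.exists_isCompact hV h.hasCompactSupport.isCompact 0 (A + 2)
  let G : ℝ × Phase d → ℝ := fun q => Real.smoothTransition (q.1 + 2) * duhamel Φ θ h q
  have hG : ContDiff ℝ ∞ G :=
    (Real.smoothTransition.contDiff.comp (contDiff_fst.add contDiff_const)).mul
      (contDiff_duhamel hΦ hV hθ hθc hh)
  have hGc : HasCompactSupport G := by
    refine HasCompactSupport.of_support_subset_isCompact ((isCompact_Icc (a := -2) (b := A)).prod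
      hK') fun q hq => ?_
    have hq1 : -2 ≤ q.1 := by
      by_contra hlt
      exact left_ne_zero_of_mul hq (Real.smoothTransition.zero_of_nonpos (by linarith))
    have hq2 := right_ne_zero_of_mul hq
    by_contra hmem
    refine hq2 (neg_eq_zero.2 (setIntegral_eq_zero_of_forall_eq_zero fun r hr => ?_))
    rw [mem_Ioi] at hr
    by_cases hr' : A < q.1 + r
    · rw [hA' _ hr', zero_mul]
    · refine mul_eq_zero_of_right _ (image_eq_zero_of_notMem_tsupport fun hmem' => hmem ?_)
      exact ⟨⟨hq1, by linarith⟩, hKK' r ⟨hr.le, by linarith⟩ _ hmem'⟩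
  refine ⟨⟨G, hG, hGc, by simp⟩, fun t ht z => ?_⟩
  change fderiv ℝ G (t, z) (1, hamField H z) = _
  have heq : G =ᶠ[𝓝 (t, z)] duhamel Φ θ h := by
    filter_upwards [(isOpen_Ioi.preimage continuous_fst).mem_nhds (show (t, z) ∈ Prod.fst ⁻¹'
      Ioi (0 : ℝ) from ht)] with q hq
    have hq' : (0 : ℝ) < q.1 := hq
    simp only [G, Real.smoothTransition.one_of_one_le (show 1 ≤ q.1 + 2 by linarith), one_mul]
  rw [heq.fderiv_eq, fderiv_duhamel hΦ hV hθ hθc hh]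

theorem IsLiouvilleSolution.unique {hH : ContDiff ℝ ∞ H} (hΦ : IsFlow (hamField H) Φ)
    {ψ₀ : PhaseTest d → ℝ} {ψ ψ' : ℝ → PhaseDistribution d} (h : IsLiouvilleSolution H hH ψ₀ ψ)
    (h' : IsLiouvilleSolution H hH ψ₀ ψ') {t : ℝ} (ht : 0 ≤ t) : ψ t = ψ' t := by
  ext f
  rcases ht.eq_or_lt with rfl | ht
  · rw [h.initial, h'.initial]
  have hc : ∀ {χ : ℝ → PhaseDistribution d}, IsLiouvilleSolution H hH ψ₀ χ →
      ContinuousOn (fun t => χ t f) (Ioi 0) := fun hχ => (hχ.continuousOn f).mono Ioi_subset_Ici_self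
  have hae : ∀ᵐ s, s ∈ Ioi (0 : ℝ) → ψ s f - ψ' s f = 0 := by
    refine isOpen_Ioi.ae_eq_zero_of_integral_contDiff_smul_eq_zero
      (((hc h).sub (hc h')).locallyIntegrableOn measurableSet_Ioi) fun θ hθ hθc hθs => ?_
    obtain ⟨g, hg⟩ := exists_liouvilleTest_eq hH hΦ hθ hθc f
    have hslice : ∀ χ : ℝ → PhaseDistribution d, ∀ s ∈ Ioi (0 : ℝ),
        χ s (timeSlice (liouvilleTest H hH g) s) = θ s * χ s f := by
      intro χ s hs
      have : timeSlice (liouvilleTest H hH g) s = θ s • f := by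
        ext z; exact hg s hs z
      rw [this, map_smul, smul_eq_mul]
    rw [← setIntegral_eq_integral_of_forall_compl_eq_zero (s := Ioi (0 : ℝ)) fun s hs => by
      rw [image_eq_zero_of_notMem_tsupport fun hmem => hs (hθs hmem), zero_smul]]
    have e1 := h.weak g
    have e2 := h'.weak g
    have i1 := h.integrableOn (liouvilleTest H hH g)
    have i2 := h'.integrableOn (liouvilleTest H hH g)
    rw [setIntegral_congr_fun measurableSet_Ioi (hslice _)] at e1 e2
    rw [integrableOn_congr_fun (hslice _) measurableSet_Ioi] at i1 i2
    simp only [smul_eq_mul, mul_sub]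
    rw [integral_sub i1 i2]
    linarith
  have heq : (fun s => ψ s f) =ᵐ[volume.restrict (Ioi 0)] fun s => ψ' s f := by
    refine (ae_restrict_iff' measurableSet_Ioi).2 (hae.mono fun s hs hs' => sub_eq_zero.1 (hs hs'))
  exact Measure.eqOn_open_of_ae_eq heq isOpen_Ioi (hc h) (hc h') ht

/-! ### The Hamilton–Jacobi equation -/

/-- A differential inequality `‖f'‖ ≤ K ‖f‖` propagates vanishing both forwards and backwards:
`‖f‖² exp (-2Ks)` decreases and `‖f‖² exp (2Ks)` increases. No derivative is required at the
endpoints. -/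
theorem eq_zero_iff_of_norm_deriv_le {F : Type*} [NormedAddCommGroup F] [InnerProductSpace ℝ F]
    {f f' : ℝ → F} {a b K : ℝ} (hab : a ≤ b) (hc : ContinuousOn f (Icc a b))
    (hd : ∀ s ∈ Ioo a b, HasDerivAt f (f' s) s) (hK : ∀ s ∈ Ioo a b, ‖f' s‖ ≤ K * ‖f s‖) :
    f a = 0 ↔ f b = 0 := by
  have hder : ∀ c : ℝ, ∀ s ∈ Ioo a b, HasDerivAt (fun s => ‖f s‖ ^ 2 * Real.exp (c * s))
      ((2 * inner ℝ (f s) (f' s) + c * ‖f s‖ ^ 2) * Real.exp (c * s)) s := by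
    intro c s hs
    have h1 := (hd s hs).norm_sq
    have h2 := ((hasDerivAt_id s).const_mul c).exp
    convert! h1.mul h2 using 1
    simp only [id, mul_one]
    ring
  have hcont : ∀ c : ℝ, ContinuousOn (fun s => ‖f s‖ ^ 2 * Real.exp (c * s)) (Icc a b) := fun c =>
    (hc.norm.pow 2).mul (by fun_prop)
  have hinner : ∀ s ∈ Ioo a b, |inner ℝ (f s) (f' s)| ≤ K * ‖f s‖ ^ 2 := by
    intro s hs
    refine (abs_real_inner_le_norm _ _).trans ?_
    nlinarith [mul_le_mul_of_nonneg_left (hK s hs) (norm_nonneg (f s))]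
  have hanti : AntitoneOn (fun s => ‖f s‖ ^ 2 * Real.exp (-(2 * K) * s)) (Icc a b) := by
    refine antitoneOn_of_deriv_nonpos (convex_Icc a b) (hcont _) ?_ ?_ <;> rw [interior_Icc]
    · exact fun s hs => (hder _ s hs).differentiableAt.differentiableWithinAt
    · intro s hs
      rw [(hder _ s hs).deriv]
      refine mul_nonpos_of_nonpos_of_nonneg ?_ (Real.exp_pos _).le
      linarith [(abs_le.1 (hinner s hs)).2]
  have hmono : MonotoneOn (fun s => ‖f s‖ ^ 2 * Real.exp (2 * K * s)) (Icc a b) := by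
    refine monotoneOn_of_deriv_nonneg (convex_Icc a b) (hcont _) ?_ ?_ <;> rw [interior_Icc]
    · exact fun s hs => (hder _ s hs).differentiableAt.differentiableWithinAt
    · intro s hs
      rw [(hder _ s hs).deriv]
      refine mul_nonneg ?_ (Real.exp_pos _).le
      linarith [(abs_le.1 (hinner s hs)).1]
  have hzero : ∀ c s : ℝ, ‖f s‖ ^ 2 * Real.exp (c * s) ≤ 0 → f s = 0 := by
    intro c s h
    have : ‖f s‖ ^ 2 ≤ 0 := nonpos_of_mul_nonpos_left h (Real.exp_pos _)
    exact norm_eq_zero.1 (pow_eq_zero_iff two_ne_zero |>.1 (le_antisymm this (by positivity)))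
  constructor <;> intro h
  · refine hzero (-(2 * K)) b ?_
    simpa [h] using hanti (left_mem_Icc.2 hab) (right_mem_Icc.2 hab) hab
  · refine hzero (2 * K) a ?_
    simpa [h] using hmono (left_mem_Icc.2 hab) (right_mem_Icc.2 hab) hab

namespace IsHamiltonJacobiSolution

variable {T : ℝ} {S : ℝ → Cfg d → ℝ}

theorem uniqueDiffOn (T : ℝ) : UniqueDiffOn ℝ (Ico 0 T ×ˢ (univ : Set (Cfg d))) :=
  (uniqueDiffOn_Ico 0 T).prod uniqueDiffOn_univ

theorem inner_gradient (hS : IsHamiltonJacobiSolution H u₀ T S) {q : ℝ × Cfg d}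
    (hq : q ∈ Ico 0 T ×ˢ (univ : Set (Cfg d))) (v : Cfg d) :
    inner ℝ (∇ (S q.1) q.2) v
      = fderivWithin ℝ (fun q : ℝ × Cfg d => S q.1 q.2) (Ico 0 T ×ˢ univ) q (0, v) := by
  have h := ((hS.contDiffOn.differentiableOn two_ne_zero) q hq).hasFDerivWithinAt
  have h1 : HasFDerivWithinAt (S q.1) _ univ q.2 :=
    HasFDerivWithinAt.comp (f := fun y : Cfg d => (q.1, y)) q.2 h
      (hasFDerivAt_prodMk_right q.1 q.2).hasFDerivWithinAt fun y _ => ⟨hq.1, mem_univ _⟩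
  rw [gradient, (h1.hasFDerivAt univ_mem).fderiv, InnerProductSpace.toDual_symm_apply]
  rfl

/-- The gradient is `C¹` up to the initial time. -/
theorem contDiffOn_gradient (hS : IsHamiltonJacobiSolution H u₀ T S) :
    ContDiffOn ℝ 1 (fun q : ℝ × Cfg d => ∇ (S q.1) q.2) (Ico 0 T ×ˢ univ) := by
  have h := hS.contDiffOn.fderivWithin (uniqueDiffOn T) (m := 1) (by norm_num)
  have h2 : ContDiffOn ℝ 1 (fun q => (InnerProductSpace.toDual ℝ (Cfg d)).symm
      (fderivWithin ℝ (fun q : ℝ × Cfg d => S q.1 q.2) (Ico 0 T ×ˢ univ) q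
        ∘L ContinuousLinearMap.inr ℝ ℝ (Cfg d))) (Ico 0 T ×ˢ univ) :=
    (InnerProductSpace.toDual ℝ (Cfg d)).symm.toContinuousLinearEquiv.contDiff.comp_contDiffOn
      (h.clm_comp contDiffOn_const)
  refine h2.congr fun q hq => ?_
  refine ext_inner_right ℝ fun v => ?_
  rw [hS.inner_gradient hq, InnerProductSpace.toDual_symm_apply]
  rfl

/-- The gradient `U = ∇S` satisfies the quasilinear system
`∂_t U + (∇_p H(x, U) · ∇) U = -∇_x H(x, U)`. -/
theorem fderiv_gradient (hS : IsHamiltonJacobiSolution H u₀ T S) (hH : ContDiff ℝ ∞ H)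
    {s : ℝ} (hs : s ∈ Ioo 0 T) (x : Cfg d) :
    fderiv ℝ (fun q : ℝ × Cfg d => ∇ (S q.1) q.2) (s, x) (1, gradP H (x, ∇ (S s) x))
      = -gradX H (x, ∇ (S s) x) := by
  set Sf : ℝ × Cfg d → ℝ := fun q => S q.1 q.2
  set U : ℝ × Cfg d → Cfg d := fun q => ∇ (S q.1) q.2
  have hHd : Differentiable ℝ H := hH.differentiable (by simp)
  have hopen : IsOpen (Ioo 0 T ×ˢ (univ : Set (Cfg d))) := isOpen_Ioo.prod isOpen_univ
  have hmem : ∀ q ∈ Ioo 0 T ×ˢ (univ : Set (Cfg d)), Ico 0 T ×ˢ (univ : Set (Cfg d)) ∈ 𝓝 q :=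
    fun q hq => mem_of_superset (hopen.mem_nhds hq)
      (prod_mono Ioo_subset_Ico_self Subset.rfl)
  have hnear : ∀ᶠ q in 𝓝 (s, x), q ∈ Ioo 0 T ×ˢ (univ : Set (Cfg d)) :=
    hopen.mem_nhds ⟨hs, mem_univ x⟩
  have hsx := hmem (s, x) ⟨hs, mem_univ x⟩
  have hS2 : ContDiffAt ℝ 2 Sf (s, x) := hS.contDiffOn.contDiffAt hsx
  have hDS : DifferentiableAt ℝ (fderiv ℝ Sf) (s, x) :=
    (hS2.fderiv_right (m := 1) (by norm_num)).differentiableAt one_ne_zero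
  have hU : DifferentiableAt ℝ U (s, x) :=
    (hS.contDiffOn_gradient.contDiffAt hsx).differentiableAt one_ne_zero
  set B := fderiv ℝ (fderiv ℝ Sf) (s, x)
  have hsymm : ∀ v w, B v w = B w v := fun v w =>
    (hS2.isSymmSndFDerivAt (by rw [minSmoothness_of_isRCLikeNormedField])).eq v w
  have hUB : ∀ w v, inner ℝ (fderiv ℝ U (s, x) w) v = B w (0, v) := by
    intro w v
    have h1 : HasFDerivAt (fun q => inner ℝ (U q) v)
        ((innerSL ℝ v) ∘L fderiv ℝ U (s, x)) (s, x) := by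
      have := ((innerSL ℝ v).hasFDerivAt).comp (s, x) hU.hasFDerivAt
      refine this.congr_of_eventuallyEq (Eventually.of_forall fun q => ?_)
      simp [real_inner_comm]
    have h2 : HasFDerivAt (fun q => fderiv ℝ Sf q (0, v)) (B.flip (0, v)) (s, x) := by
      simpa using hDS.hasFDerivAt.clm_apply (hasFDerivAt_const ((0 : ℝ), v) (s, x))
    have h3 : (fun q => inner ℝ (U q) v) =ᶠ[𝓝 (s, x)] fun q => fderiv ℝ Sf q (0, v) := by
      filter_upwards [hnear] with q hq
      rw [hS.inner_gradient ⟨Ioo_subset_Ico_self hq.1, hq.2⟩, fderivWithin_of_mem_nhds (hmem q hq)]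
    have h4 := congrArg (fun L => L w) (h1.unique (h2.congr_of_eventuallyEq h3))
    simpa [real_inner_comm] using h4
  -- the derivative of the equation in a spatial direction
  have heq : ∀ v, B (0, v) (1, 0)
      + fderiv ℝ H (x, U (s, x)) (v, fderiv ℝ U (s, x) (0, v)) = 0 := by
    intro v
    have h1 : HasFDerivAt (fun q => fderiv ℝ Sf q (1, 0)) (B.flip (1, 0)) (s, x) := by
      simpa using hDS.hasFDerivAt.clm_apply (hasFDerivAt_const ((1 : ℝ), (0 : Cfg d)) (s, x))
    have h2 : HasFDerivAt (fun q : ℝ × Cfg d => H (q.2, U q))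
        (fderiv ℝ H (x, U (s, x)) ∘L
          (ContinuousLinearMap.snd ℝ ℝ (Cfg d)).prod (fderiv ℝ U (s, x))) (s, x) :=
      HasFDerivAt.comp (f := fun q : ℝ × Cfg d => (q.2, U q)) (s, x) (hHd _).hasFDerivAt
        (hasFDerivAt_snd.prodMk hU.hasFDerivAt)
    have h3 : (fun q => fderiv ℝ Sf q (1, 0) + H (q.2, U q)) =ᶠ[𝓝 (s, x)] fun _ => 0 := by
      filter_upwards [hnear] with q hq
      have hd : HasDerivAt (fun r => S r q.2) (fderiv ℝ Sf q (1, 0)) q.1 :=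
        HasFDerivAt.comp_hasDerivAt (f := fun r : ℝ => (r, q.2)) q.1
          (((hS.contDiffOn.contDiffAt (hmem q hq)).differentiableAt two_ne_zero).hasFDerivAt)
          ((hasDerivAt_id' q.1).prodMk (hasDerivAt_const q.1 q.2))
      rw [← hd.deriv]
      exact hS.equation q.1 hq.1 q.2
    have h4 := congrArg (fun L => L (0, v))
      ((h1.add h2).unique ((hasFDerivAt_const (0 : ℝ) (s, x)).congr_of_eventuallyEq h3))
    simpa using h4
  refine ext_inner_right ℝ fun v => ?_
  have hHdec : ∀ z : Phase d, ∀ a b, fderiv ℝ H z (a, b)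
      = inner ℝ (gradX H z) a + inner ℝ (gradP H z) b := by
    intro z a b
    rw [inner_gradX hHd, inner_gradP hHd, ← map_add]
    simp
  have e := heq v
  have e1 : inner ℝ (gradP H (x, U (s, x))) (fderiv ℝ U (s, x) (0, v))
      = B (0, v) (0, gradP H (x, U (s, x))) := by rw [real_inner_comm, hUB]
  rw [hHdec, e1] at e
  have e2 : B (1, gradP H (x, U (s, x))) (0, v)
      = B (0, v) (1, 0) + B (0, v) (0, gradP H (x, U (s, x))) := by
    rw [hsymm, ← map_add]
    simp
  rw [hUB, inner_neg_left]
  change B (1, gradP H (x, U (s, x))) (0, v) = -inner ℝ (gradX H (x, U (s, x))) v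
  linarith

/-- A bicharacteristic that meets the graph of the gradient of a `C²` solution at one time stays on
it. Along the bicharacteristic `(X, P)` the difference `P - ∇S(s, X)` obeys a linear differential
inequality, so it vanishes at time `t` if and only if it vanishes initially. -/
theorem mem_graph_iff (hS : IsHamiltonJacobiSolution H u₀ T S) (hH : ContDiff ℝ ∞ H)
    (hΦ : IsFlow (hamField H) Φ) {t : ℝ} (ht : t ∈ Ico 0 T) (y : Phase d) :
    y.2 = u₀ y.1 ↔ (Φ t y).2 = ∇ (S t) (Φ t y).1 := by
  set U : ℝ × Cfg d → Cfg d := fun q => ∇ (S q.1) q.2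
  have hV := contDiff_hamField hH
  have hV1 : ContDiff ℝ 1 (hamField H) := hV.of_le (by exact_mod_cast le_top)
  have hΦc := hΦ.continuous_time y
  have hcurve : Continuous fun s => (s, (Φ s y).1) := continuous_id.prodMk hΦc.fst
  have hmaps : MapsTo (fun s => (s, (Φ s y).1)) (Icc 0 t) (Ico 0 T ×ˢ (univ : Set (Cfg d))) :=
    fun s hs => ⟨⟨hs.1, hs.2.trans_lt ht.2⟩, mem_univ _⟩
  have hUc : ContinuousOn (fun s => U (s, (Φ s y).1)) (Icc 0 t) :=
    hS.contDiffOn_gradient.continuousOn.comp hcurve.continuousOn hmaps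
  obtain ⟨C, hC⟩ := isCompact_Icc.exists_bound_of_continuousOn
    ((hS.contDiffOn_gradient.continuousOn_fderivWithin (uniqueDiffOn T) le_rfl).comp
      hcurve.continuousOn hmaps)
  -- a ball containing both curves, on which the Hamiltonian field is Lipschitz
  have hUc' : ContinuousOn (fun s => ((Φ s y).1, U (s, (Φ s y).1))) (Icc 0 t) :=
    hΦc.fst.continuousOn.prodMk hUc
  obtain ⟨R, hR⟩ := ((isCompact_Icc.image_of_continuousOn hUc').union
    (isCompact_Icc (a := 0) (b := t) |>.image hΦc)).isBounded.subset_closedBall (0 : Phase d)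
  obtain ⟨L, hL⟩ := hV1.contDiffOn.exists_lipschitzOnWith one_ne_zero (convex_closedBall 0 R)
    (isCompact_closedBall (0 : Phase d) R)
  have key := eq_zero_iff_of_norm_deriv_le (a := 0) (b := t) (K := L + C * L)
    (f := fun s => (Φ s y).2 - U (s, (Φ s y).1))
    (f' := fun s => -gradX H (Φ s y)
      - fderiv ℝ U (s, (Φ s y).1) (1, gradP H (Φ s y))) ht.1
    (hΦc.snd.continuousOn.sub hUc) (fun s hs => ?_) (fun s hs => ?_)
  · rw [sub_eq_zero, sub_eq_zero, hΦ.zero] at key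
    rw [← key]
    simp only [U, hS.initial]
  · have hs' : s ∈ Ioo 0 T := ⟨hs.1, hs.2.trans ht.2⟩
    have hU : DifferentiableAt ℝ U (s, (Φ s y).1) :=
      (hS.contDiffOn_gradient.contDiffAt (mem_of_superset ((isOpen_Ioo.prod isOpen_univ).mem_nhds
        ⟨hs', mem_univ _⟩) (prod_mono Ioo_subset_Ico_self Subset.rfl))).differentiableAt
          one_ne_zero
    have hX : HasDerivAt (fun r => (Φ r y).1) (gradP H (Φ s y)) s :=
      (ContinuousLinearMap.fst ℝ (Cfg d) (Cfg d)).hasFDerivAt.comp_hasDerivAt s (hΦ.hasDerivAt y s)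
    have hP : HasDerivAt (fun r => (Φ r y).2) (-gradX H (Φ s y)) s :=
      (ContinuousLinearMap.snd ℝ (Cfg d) (Cfg d)).hasFDerivAt.comp_hasDerivAt s (hΦ.hasDerivAt y s)
    exact hP.sub (HasFDerivAt.comp_hasDerivAt (f := fun r => (r, (Φ r y).1)) s hU.hasFDerivAt
      ((hasDerivAt_id' s).prodMk hX))
  · have hs' : s ∈ Ioo 0 T := ⟨hs.1, hs.2.trans ht.2⟩
    have hsI : s ∈ Icc 0 t := Ioo_subset_Icc_self hs
    set x := (Φ s y).1
    set p := (Φ s y).2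
    have hz : Φ s y = (x, p) := rfl
    have hlip : ‖hamField H (x, p) - hamField H (x, U (s, x))‖ ≤ L * ‖p - U (s, x)‖ := by
      have h := hL.norm_sub_le (x := (x, p)) (hR (Or.inr ⟨s, hsI, rfl⟩))
        (y := (x, U (s, x))) (hR (Or.inl ⟨s, hsI, rfl⟩))
      refine h.trans (le_of_eq ?_)
      simp [Prod.norm_def]
    have hp : ‖gradP H (x, p) - gradP H (x, U (s, x))‖ ≤ L * ‖p - U (s, x)‖ :=
      (norm_fst_le (hamField H (x, p) - hamField H (x, U (s, x)))).trans hlip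
    have hx : ‖-gradX H (x, p) - -gradX H (x, U (s, x))‖ ≤ L * ‖p - U (s, x)‖ :=
      (norm_snd_le (hamField H (x, p) - hamField H (x, U (s, x)))).trans hlip
    have hDU : ‖fderiv ℝ U (s, x)‖ ≤ C := by
      rw [← fderivWithin_of_mem_nhds (s := Ico 0 T ×ˢ (univ : Set (Cfg d)))
        (mem_of_superset ((isOpen_Ioo.prod isOpen_univ).mem_nhds ⟨hs', mem_univ x⟩)
          (prod_mono Ioo_subset_Ico_self Subset.rfl))]
      exact hC s hsI
    have heq : -gradX H (x, p) - fderiv ℝ U (s, x) (1, gradP H (x, p))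
        = (-gradX H (x, p) - -gradX H (x, U (s, x)))
          - fderiv ℝ U (s, x) (0, gradP H (x, p) - gradP H (x, U (s, x))) := by
      have h1 : ((0 : ℝ), gradP H (x, p) - gradP H (x, U (s, x)))
          = (1, gradP H (x, p)) - (1, gradP H (x, U (s, x))) := by simp
      rw [h1, map_sub, hS.fderiv_gradient hH hs' x]
      abel
    rw [hz, heq, add_mul]
    refine (norm_sub_le _ _).trans (add_le_add hx ?_)
    refine ((fderiv ℝ U (s, x)).le_opNorm _).trans ?_
    rw [mul_assoc]
    refine mul_le_mul hDU ?_ (norm_nonneg _) ((norm_nonneg _).trans hDU)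
    simpa [Prod.norm_def] using hp

end IsHamiltonJacobiSolution

end LiouvilleLevelSet

theorem mainTheorem4 (d M : ℕ) (hd : 0 < d) (hM : 0 < M)
    (H : Phase d → ℝ) (hH : ContDiff ℝ ∞ H) (hflow : HasCompleteFlow H)
    (u₀ : Fin M → Cfg d → Cfg d) (hu₀ : ∀ k, ContDiff ℝ 1 (u₀ k)) :
    -- the level-set functions exist and are unique
    (∃ φ : Fin M → ℝ → Phase d → Cfg d, ∀ k, IsLevelSetFunction H (u₀ k) (φ k)) ∧
    (∀ k, ∀ φ φ' : ℝ → Phase d → Cfg d, IsLevelSetFunction H (u₀ k) φ →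
      IsLevelSetFunction H (u₀ k) φ' → ∀ t, 0 ≤ t → ∀ z, φ t z = φ' t z) ∧
    ∀ φ : Fin M → ℝ → Phase d → Cfg d, (∀ k, IsLevelSetFunction H (u₀ k) (φ k)) →
      -- the solution of the Liouville equation is the average of the `δ(φ k)`
      (∃ δφ : Fin M → ℝ → PhaseDistribution d,
        (∀ k t, 0 ≤ t → IsDeltaComp (φ k t) (δφ k t)) ∧
        ∀ ψ : ℝ → PhaseDistribution d,
          IsLiouvilleSolution H hH
              (fun g => (1 / (M : ℝ)) * ∑ k, prodDeltaPairing (u₀ k) g) ψ ↔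
            ∀ t, 0 ≤ t → ψ t = (1 / (M : ℝ)) • ∑ k, δφ k t) ∧
      -- the zero level set of `φ k` represents the Hamilton-Jacobi solution while it is smooth
      (∀ k, ∀ (T : ℝ) (S : ℝ → Cfg d → ℝ), IsHamiltonJacobiSolution H (u₀ k) T S →
        ∀ t ∈ Ico 0 T, ∀ x p : Cfg d, φ k t (x, p) = 0 ↔ p = ∇ (S t) x) := by
  obtain ⟨Φ, hΦ⟩ := exists_isFlow hflow
  have hV := contDiff_hamField hH
  have hV1 : ContDiff ℝ 1 (hamField H) := hV.of_le (by exact_mod_cast le_top)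
  refine ⟨⟨_, fun k => isLevelSetFunction_comp_flow hH hΦ (hu₀ k)⟩, fun k φ φ' hφ hφ' t ht z => by
    rw [hφ.eq_comp_flow hH hΦ ht, hφ'.eq_comp_flow hH hΦ ht], fun φ hφ => ⟨?_, ?_⟩⟩
  · have hfin := fun k => isFiniteMeasureOnCompacts_graphMeasure (hu₀ k).continuous
    let δφ : Fin M → ℝ → PhaseDistribution d := fun k t =>
      measureDistribution ((graphMeasure (u₀ k)).map (Φ t))
    have hδ : ∀ k t g, δφ k t g = ∫ z, g (Φ t z) ∂(graphMeasure (u₀ k)) := fun k t g =>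
      measureDistribution_map_apply hΦ hH _ t g
    have hsol : IsLiouvilleSolution H hH
        (fun g => (1 / (M : ℝ)) * ∑ k, prodDeltaPairing (u₀ k) g)
        fun t => (1 / (M : ℝ)) • ∑ k, δφ k t := by
      have h := IsLiouvilleSolution.const_mul_sum
        (fun k => isLiouvilleSolution_of_transport hH hΦ (graphMeasure (u₀ k))
          fun t _ g => hδ k t g) (1 / (M : ℝ))
      convert! h using 5 with g k
      rw [prodDeltaPairing_eq, integral_graphMeasure (hu₀ k).continuous g.continuous]
    refine ⟨δφ, fun k t ht => ?_, fun ψ => ⟨fun hψ t ht => hψ.unique hΦ hsol ht, fun hψ => ?_⟩⟩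
    · have : φ k t = fun z => (Φ (-t) z).2 - u₀ k (Φ (-t) z).1 :=
        funext fun z => (hφ k).eq_comp_flow hH hΦ ht z
      rw [this]
      refine isDeltaComp_comp_flow hH hΦ (hu₀ k) t fun g => ?_
      rw [hδ, integral_graphMeasure (g := fun z => g (Φ t z)) (hu₀ k).continuous
        (g.continuous.comp (hΦ.contDiff_apply hV t).continuous)]
    · exact hsol.congr hψ
  · intro k T S hS t ht x p
    rw [(hφ k).eq_comp_flow hH hΦ ht.1, sub_eq_zero, hS.mem_graph_iff hH hΦ ht,
      hΦ.apply_neg hV1]
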